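/- **Setting.** Let $n\ge 1$, let $\mathfrak g$ be the complex simple Lie algebra of type $B_n$ with Cartan subalgebra $\mathfrak h$, simple roots $\alpha_i=e_i-e_{i+1}$ ($1\le i<n$), $\alpha_n=e_n$, and $\mathfrak n_+$ the sum of the positive root spaces. The positive roots are indexed by the pairs $(r,s)$ with $1\le r\le s\le 2n-r$: $(r,s)$ is the root whose first nonzero coefficient in the basis of simple roots is that of $\alpha_r$ and whose height is $s-r+1$. Let $\tilde{\mathfrak g}=(\mathfrak g\otimes\mathbb C[t,t^{-1}])\oplus\mathbb Cc\oplus\mathbb Cd$ be the untwisted affine Lie algebra of type $\tilde B_n$, with $c$ central, $[x\otimes t^k,y\otimes t^l]=[x,y]\otimes t^{k+l}+k\,\delta_{k+l,0}(x|y)c$ for the Killing form $(\cdot|\cdot)$, and $[d,x\otimes t^k]=k\,x\otimes t^k$. Put $\tilde{\mathfrak h}=(\mathfrak h\otimes 1)\oplus\mathbb Cc\oplus\mathbb Cd$, $\tilde{\mathfrak n}_+=(\mathfrak n_+\otimes 1)\oplus\bigoplus_{k>0}\mathfrak g\otimes t^k$, $\tilde{\mathfrak b}=\tilde{\mathfrak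 h}\oplus\tilde{\mathfrak n}_+$. Let $\delta\in\tilde{\mathfrak h}^*$ be $1$ on $d$ and $0$ on $c$ and $\mathfrak h$, let $D_2$ be the set of the positive roots $(r,s)$ of $B_n$ (extended by $0$ to $c,d$), $D_3=\{\delta-(r,s)\}$ and $D=\{\delta\}\cup D_2\cup D_3$. A *basic ideal* is an ideal $\mathfrak i$ of $\tilde{\mathfrak b}$, contained in $\tilde{\mathfrak n}_+$ and of finite codimension, such that $\mathfrak i\cap\tilde{\mathfrak g}_\alpha\in\{0,\tilde{\mathfrak g}_\alpha\}$ for each positive root $\alpha$ of $\tilde{\mathfrak g}$, and whose support $\operatorname{supp}(\mathfrak i)$, the set of positive roots $\alpha$ with $\tilde{\mathfrak g}_\alpha\subset\mathfrak i$, meets $D$. A *$B_n$-path* is a word of length $2n$ in the letters $r,f$ each prefix of which contains at least as many $r$'s as $f$'s. $\mathfrak B_n(i,j)$ is the set of $B_n$-paths whose first and second $f$ are at the positions $i<j$, where missing $f$'s are thought of as following the word immediately (so a path whose only $f$ is at position $k$ lies in $\mathfrak B_n(k,2n+1)$, and $\mathfrak B_n(2n+1,2n+2)=\{rr\cdots r\}$).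 Represent $(r,s)\in D_2$ by the unit box with northwest corner $(s-1,1-r)$ in $\mathbb R^2$, and $\delta-(r,s)\in D_3$ by the unit box with northwest corner $(2n-s-1,r+1)$. A pair $(p,q)$ of $B_n$-paths is *admissible* if there is a basic ideal $\mathfrak i$ such that (1) the lattice path which starts at $(-1,0)$ and, reading $p$, goes one step right for each $r$ and one step down for each $f$, has to its northeast exactly the boxes of $D_2\cap\operatorname{supp}(\mathfrak i)$ among those of $D_2$; and (2) the lattice path which starts at $(2n,1)$ and, reading $q$, goes one step left for each $r$ and one step up for each $f$, has to its northeast exactly the boxes of $D_3\cap\operatorname{supp}(\mathfrak i)$ among those of $D_3$. **Proposition.** Let $p\in\mathfrak B_n(a,b)$ with $3\le a<b\le 2n$. Then $(p,q)$ is an admissible pair if and only if $q\in\mathfrak B_n(i,j)$ for some $i\ge 2n+4-b$ and $j\ge 2n+4-a$. Consequently, the number of $q$ such that $(p,q)$ is admissible is $$\sum_{i\ge 2n+4-b}\ \sum_{j\ge 2n+4-a}|\mathfrak B_n(i,j)|,$$ where only terms with $i<j\le 2n+2$ can be nonzero. -/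

import Mathlib

open scoped TensorProduct

noncomputable section

namespace AffineB

/-! ### The simple Lie algebra of type `B_n` -/

/-- The complex simple Lie algebra of type `B_n`: the orthogonal Lie algebra of rank `n` in
`2 n + 1` dimensions, realised by matrices indexed by `Unit ⊕ Fin n ⊕ Fin n`. -/
abbrev G (n : ℕ) : Type := ↥(LieAlgebra.Orthogonal.typeB (Fin n) ℂ)

/-- The Cartan subalgebra `𝔥` of diagonal matrices,
`diag(0, x_1, …, x_n, -x_1, …, -x_n)`. -/
def cartan (n : ℕ) : Submodule ℂ (G n) where
  carrier := {x | (x : Matrix (Unit ⊕ Fin n ⊕ Fin n) (Unit ⊕ Fin n ⊕ Fin n) ℂ).IsDiag}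
  add_mem' hx hy := hx.add hy
  zero_mem' := Matrix.isDiag_zero
  smul_mem' c _ hx := hx.smul c

/-- The functional `e_i`, `1 ≤ i ≤ n`, which on `𝔥` is `diag(0, x, -x) ↦ x_i`; by convention
`e_i = 0` for any other `i`. It is written as a functional on all of `𝔤`, but only its
restriction to `𝔥` is ever used. -/
def eps (n i : ℕ) : G n →ₗ[ℂ] ℂ :=
  if h : 1 ≤ i ∧ i ≤ n then
    { toFun := fun x => x.1 (Sum.inr (Sum.inl ⟨i - 1, by omega⟩)) (Sum.inr (Sum.inl ⟨i - 1, by omega⟩))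
      map_add' := fun _ _ => rfl
      map_smul' := fun _ _ => rfl }
  else 0

/-- The simple roots: `α_i = e_i - e_{i+1}` for `1 ≤ i < n`, and `α_n = e_n` (as `e_{n+1} = 0`). -/
def simpleRoot (n i : ℕ) : G n →ₗ[ℂ] ℂ := eps n i - eps n (i + 1)

/-- The index pairs `(r, s)` of the positive roots of `B_n`. -/
def IsRootIndex (n r s : ℕ) : Prop := 1 ≤ r ∧ r ≤ s ∧ r + s ≤ 2 * n

/-- The positive root `(r, s)` of `B_n`: the root whose first nonzero coefficient in the basis of
simple roots is that of `α_r`, and whose height is `s - r + 1`. For `s ≤ n` it is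
`α_r + ⋯ + α_s`, and for `s = 2 n - k > n` it is
`α_r + ⋯ + α_k + 2 α_{k+1} + ⋯ + 2 α_n`. -/
def posRoot (n r s : ℕ) : G n →ₗ[ℂ] ℂ :=
  ∑ i ∈ Finset.Icc r (min s n), simpleRoot n i +
    ∑ i ∈ Finset.Icc (2 * n + 1 - s) n, simpleRoot n i

/-- The root space `𝔤_γ = {x | [h, x] = γ(h) x for all h ∈ 𝔥}`. -/
def finRootSpace (n : ℕ) (γ : G n →ₗ[ℂ] ℂ) : Submodule ℂ (G n) where
  carrier := {x | ∀ h ∈ cartan n, ⁅h, x⁆ = γ h • x}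
  add_mem' hx hy h hh := by rw [lie_add, hx h hh, hy h hh, smul_add]
  zero_mem' h _ := by simp
  smul_mem' c x hx h hh := by rw [lie_smul, hx h hh, smul_comm]

/-- `𝔫₊`, the sum of the root spaces of the positive roots of `B_n`. -/
def nPlus (n : ℕ) : Submodule ℂ (G n) :=
  ⨆ (r : ℕ) (s : ℕ) (_ : IsRootIndex n r s), finRootSpace n (posRoot n r s)

/-! ### The untwisted affine Lie algebra of type `B̃_n` -/

/-- The loop algebra `ℂ[t, t⁻¹] ⊗ 𝔤`. -/
abbrev Loop (n : ℕ) : Type := LieAlgebra.loopAlgebra ℂ ℤ (G n)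

lemma neg_killingForm_lieInvariant (n : ℕ) :
    LinearMap.BilinForm.lieInvariant (G n) (-killingForm ℂ (G n)) := fun x y z => by
  simpa using congrArg Neg.neg (LieModule.traceForm_lieInvariant ℂ (G n) (G n) x y z)

lemma neg_killingForm_isSymm (n : ℕ) : (-killingForm ℂ (G n)).IsSymm :=
  ⟨fun x y => by simpa using LieModule.traceForm_comm ℂ (G n) (G n) x y⟩

/-- The 2-cocycle `(x ⊗ t^k, y ⊗ t^l) ↦ k (x | y) δ_{k + l, 0}`, with `( | )` the Killing form.
(Mathlib's cocycle attached to a form `Φ` is `l Φ(x, y) δ_{k + l, 0}`, whence the sign.) -/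
def cocycle (n : ℕ) : LieModule.Cohomology.twoCocycle ℂ (Loop n)
    (TrivialLieModule ℂ (Loop n) ℂ) :=
  LieAlgebra.LoopAlgebra.twoCocycleOfBilinear ℂ ℤ (G n) (-killingForm ℂ (G n))
    (neg_killingForm_lieInvariant n) (neg_killingForm_isSymm n)

lemma cocycle_tmul (n : ℕ) (k l : ℤ) (x y : G n) :
    (cocycle n).1 ((AddMonoidAlgebra.single k 1 : AddMonoidAlgebra ℂ ℤ) ⊗ₜ[ℂ] x)
        ((AddMonoidAlgebra.single l 1 : AddMonoidAlgebra ℂ ℤ) ⊗ₜ[ℂ] y) =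
      (TrivialLieModule.equiv ℂ (Loop n) ℂ).symm
        (if k + l = 0 then (k : ℂ) * killingForm ℂ (G n) x y else 0) := by
  simp only [cocycle, LieAlgebra.LoopAlgebra.twoCocycleOfBilinear_coe,
    LieAlgebra.LoopAlgebra.twoCochainOfBilinear_apply_apply,
    LieAlgebra.LoopAlgebra.residuePairing_apply_apply,
    LieAlgebra.LoopAlgebra.toFinsupp_single_tmul]
  rw [Finsupp.sum_single_index (by simp)]
  split_ifs with h
  · obtain rfl : l = -k := by omega
    simp
  · rw [Finsupp.single_eq_of_ne (by omega)]
    simp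

/-- The central extension `(ℂ[t, t⁻¹] ⊗ 𝔤) ⊕ ℂ c`. -/
abbrev Central (n : ℕ) : Type := LieAlgebra.ofTwoCocycle (cocycle n)

/-- The linear map `x ⊗ t^k ↦ k (x ⊗ t^k)` of the loop algebra. -/
def loopDegree (n : ℕ) : Loop n →ₗ[ℂ] Loop n :=
  LinearMap.rTensor (G n) ((AddMonoidAlgebra.basis ℤ ℂ).constr ℂ
    (fun k : ℤ => (k : ℂ) • (AddMonoidAlgebra.single k 1 : AddMonoidAlgebra ℂ ℤ)))

lemma loopDegree_tmul (n : ℕ) (k : ℤ) (x : G n) :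
    loopDegree n (AddMonoidAlgebra.single k 1 ⊗ₜ x) =
      (k : ℂ) • ((AddMonoidAlgebra.single k 1 : AddMonoidAlgebra ℂ ℤ) ⊗ₜ[ℂ] x) := by
  simp only [loopDegree, LinearMap.rTensor_tmul, TensorProduct.smul_tmul']
  rw [← AddMonoidAlgebra.basis_apply, Module.Basis.constr_basis, AddMonoidAlgebra.basis_apply]

lemma loop_induction {n : ℕ} {P : Loop n → Prop} (x : Loop n)
    (add : ∀ x y, P x → P y → P (x + y))
    (tmul : ∀ (k : ℤ) (x : G n), P ((AddMonoidAlgebra.single k 1 : AddMonoidAlgebra ℂ ℤ) ⊗ₜ[ℂ] x)) :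
    P x := by
  rw [← (LieAlgebra.LoopAlgebra.toFinsupp ℂ ℤ (G n)).symm_apply_apply x]
  induction LieAlgebra.LoopAlgebra.toFinsupp ℂ ℤ (G n) x using Finsupp.induction_linear with
  | zero => simpa using tmul 0 0
  | add f g hf hg => rw [map_add]; exact add _ _ hf hg
  | single k x => rw [LieAlgebra.LoopAlgebra.toFinsupp_symm_single]; exact tmul k x

lemma loopDegree_lie (n : ℕ) (x y : Loop n) :
    loopDegree n ⁅x, y⁆ = ⁅x, loopDegree n y⁆ - ⁅y, loopDegree n x⁆ := by
  have hskew : ⁅y, loopDegree n x⁆ = -⁅loopDegree n x, y⁆ := (lie_skew y (loopDegree n x)).symm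
  rw [hskew, sub_neg_eq_add]
  clear hskew
  induction x using loop_induction with
  | add x x' hx hx' =>
    have h1 (z : Loop n) : ⁅x + x', z⁆ = ⁅x, z⁆ + ⁅x', z⁆ := add_lie x x' z
    have h2 : ⁅loopDegree n x + loopDegree n x', y⁆ = ⁅loopDegree n x, y⁆ + ⁅loopDegree n x', y⁆ :=
      add_lie _ _ y
    rw [h1, h1, map_add, map_add, h2, hx, hx']; abel
  | tmul k x =>
    induction y using loop_induction with
    | add y y' hy hy' =>
      have h1 (z : Loop n) : ⁅z, y + y'⁆ = ⁅z, y⁆ + ⁅z, y'⁆ := lie_add z y y'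
      have h2 (z : Loop n) : ⁅z, loopDegree n y + loopDegree n y'⁆ =
        ⁅z, loopDegree n y⁆ + ⁅z, loopDegree n y'⁆ := lie_add z _ _
      rw [h1, h1, map_add, map_add, h2, hy, hy']; abel
    | tmul l y =>
      have h1 (a : ℂ) (z w : Loop n) : ⁅z, a • w⁆ = a • ⁅z, w⁆ := lie_smul a z w
      have h2 (a : ℂ) (z w : Loop n) : ⁅a • z, w⁆ = a • ⁅z, w⁆ := smul_lie a z w
      simp only [loopDegree_tmul, LieAlgebra.ExtendScalars.bracket_tmul,
        AddMonoidAlgebra.single_mul_single, mul_one, h1, h2, ← add_smul]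
      push_cast
      rw [add_comm (k : ℂ)]

lemma cocycle_loopDegree (n : ℕ) (x y : Loop n) :
    (cocycle n).1 x (loopDegree n y) - (cocycle n).1 y (loopDegree n x) = 0 := by
  rw [← LieModule.Cohomology.twoCochain_skew (cocycle n).1 (loopDegree n x) y, sub_neg_eq_add]
  induction x using loop_induction with
  | add x x' hx hx' =>
    simp only [map_add, LinearMap.add_apply]
    rw [add_add_add_comm, hx, hx', add_zero]
  | tmul k x =>
    induction y using loop_induction with
    | add y y' hy hy' =>
      simp only [map_add]
      rw [add_add_add_comm, hy, hy', add_zero]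
    | tmul l y =>
      simp only [loopDegree_tmul, map_smul, LinearMap.smul_apply, ← add_smul]
      by_cases hkl : l + k = 0
      · rw [show (l : ℂ) + (k : ℂ) = 0 by exact_mod_cast hkl, zero_smul]
      · rw [cocycle_tmul, if_neg (by omega), map_zero, smul_zero]

/-- The degree derivation of the central extension:
`x ⊗ t^k ↦ k (x ⊗ t^k)` and `c ↦ 0`. -/
def degree (n : ℕ) : LieDerivation ℂ (Central n) (Central n) where
  toFun z := LieAlgebra.ofProd (cocycle n)
    (loopDegree n ((LieAlgebra.ofProd (cocycle n)).symm z).1, 0)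
  map_add' x y := by
    rw [← LieAlgebra.of_add]; simp
  map_smul' a x := by
    simp [← LieAlgebra.of_smul]
  leibniz' x y := by
    have h (z w : Central n) : z - w = LieAlgebra.ofProd (cocycle n)
        ((LieAlgebra.ofProd (cocycle n)).symm z - (LieAlgebra.ofProd (cocycle n)).symm w) := rfl
    rw [h]
    simp only [LinearMap.coe_mk, AddHom.coe_mk, LieAlgebra.bracket_ofTwoCocycle,
      Equiv.symm_apply_apply]
    refine congrArg _ (Prod.ext ?_ ?_)
    · exact loopDegree_lie n _ _
    · simpa [LieModule.IsTrivial.trivial] using (cocycle_loopDegree n _ _).symm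

attribute [local instance 100] LieRing.ofAssociativeRing

/-- The action of the one-dimensional Lie algebra `ℂ d`, with `d` acting as the degree
derivation. -/
def degreeAction (n : ℕ) : ℂ →ₗ⁅ℂ⁆ LieDerivation ℂ (Central n) (Central n) where
  toFun a := a • degree n
  map_add' a b := add_smul a b _
  map_smul' a b := by simp [mul_smul]
  map_lie' {a b} := by simp [LieRing.of_associative_ring_bracket, mul_comm]

/-- The untwisted affine Kac–Moody algebra `𝔤̃ = (ℂ[t, t⁻¹] ⊗ 𝔤) ⊕ ℂ c ⊕ ℂ d`. -/
abbrev GAff (n : ℕ) : Type := LieAlgebra.SemiDirectSum (Central n) ℂ (degreeAction n)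

/-- The element `x ⊗ t^k`. -/
def mono (n : ℕ) (x : G n) (k : ℤ) : GAff n :=
  ⟨LieAlgebra.ofProd (cocycle n) ((AddMonoidAlgebra.single k 1 : AddMonoidAlgebra ℂ ℤ) ⊗ₜ[ℂ] x, 0), 0⟩

/-- The central element `c`. -/
def cElt (n : ℕ) : GAff n :=
  ⟨LieAlgebra.ofProd (cocycle n) (0, (TrivialLieModule.equiv ℂ (Loop n) ℂ).symm 1), 0⟩

/-- The derivation `d`. -/
def dElt (n : ℕ) : GAff n := ⟨0, 1⟩

/-- `𝔥̃`, the span of `c`, `d` and the `h ⊗ 1` with `h ∈ 𝔥`. -/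
def cartanAff (n : ℕ) : Submodule ℂ (GAff n) :=
  Submodule.span ℂ ({cElt n, dElt n} ∪ {z | ∃ h ∈ cartan n, z = mono n h 0})

/-- `𝔫̃₊`, the span of the `x ⊗ 1` with `x ∈ 𝔫₊` and the `x ⊗ t^k` with `x ∈ 𝔤`, `k > 0`. -/
def nPlusAff (n : ℕ) : Submodule ℂ (GAff n) :=
  Submodule.span ℂ ({z | ∃ x ∈ nPlus n, z = mono n x 0} ∪
    {z | ∃ (x : G n) (k : ℤ), 0 < k ∧ z = mono n x k})

/-- The Borel subalgebra `𝔟̃ = 𝔥̃ ⊕ 𝔫̃₊`. -/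
def borelAff (n : ℕ) : Submodule ℂ (GAff n) := cartanAff n ⊔ nPlusAff n

/-- The root space `𝔤̃_α = {x | [h, x] = α(h) x for all h ∈ 𝔥̃}` of `α ∈ 𝔥̃*`. -/
def rootSpace (n : ℕ) (α : Module.Dual ℂ (cartanAff n)) : Submodule ℂ (GAff n) where
  carrier := {x | ∀ h : cartanAff n, ⁅(h : GAff n), x⁆ = α h • x}
  add_mem' hx hy h := by rw [lie_add, hx h, hy h, smul_add]
  zero_mem' h := by rw [lie_zero, smul_zero]
  smul_mem' c x hx h := by rw [lie_smul, hx h, smul_comm]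

/-- The positive roots: the nonzero `α ∈ 𝔥̃*` with a nonzero root space, contained in `𝔫̃₊`. -/
def IsPositiveRoot (n : ℕ) (α : Module.Dual ℂ (cartanAff n)) : Prop :=
  α ≠ 0 ∧ rootSpace n α ≠ ⊥ ∧ rootSpace n α ≤ nPlusAff n

/-! ### The set `D` of positive roots -/

/-- The linear map taking an element of `𝔤̃` to its coefficient at `t^0`, which lies in `𝔤`. -/
def zeroMode (n : ℕ) : GAff n →ₗ[ℂ] G n where
  toFun z := LieAlgebra.LoopAlgebra.toFinsupp ℂ ℤ (G n)
    ((LieAlgebra.ofProd (cocycle n)).symm z.left).1 0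
  map_add' x y := by simp
  map_smul' a x := by simp

/-- The root `(r, s)` of `B_n` as a functional on `𝔥̃`, zero on `c` and `d`: an element of `D₂`. -/
def rootD2 (n r s : ℕ) : Module.Dual ℂ (cartanAff n) :=
  ((posRoot n r s).comp (zeroMode n)).domRestrict (cartanAff n)

/-- The indivisible positive imaginary root `δ`: it is `1` on `d` and zero on `c` and on `𝔥`. -/
def delta (n : ℕ) : Module.Dual ℂ (cartanAff n) :=
  ({ toFun := fun z => z.right
     map_add' := fun _ _ => rfl
     map_smul' := fun _ _ => rfl } : GAff n →ₗ[ℂ] ℂ).domRestrict (cartanAff n)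

/-- The root `δ - (r, s)`: an element of `D₃`. -/
def rootD3 (n r s : ℕ) : Module.Dual ℂ (cartanAff n) := delta n - rootD2 n r s

/-- `D = D₁ ∪ D₂ ∪ D₃`, where `D₁ = {δ}`. -/
def D (n : ℕ) : Set (Module.Dual ℂ (cartanAff n)) :=
  {delta n} ∪ {α | ∃ r s, IsRootIndex n r s ∧ α = rootD2 n r s} ∪
    {α | ∃ r s, IsRootIndex n r s ∧ α = rootD3 n r s}

/-! ### Basic ideals -/

/-- `I` is a combinatorial ideal: an ideal of `𝔟̃` contained in `𝔫̃₊`, of finite codimension,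
which contains or meets trivially each root space of a positive root. -/
structure IsCombinatorialIdeal (n : ℕ) (I : Submodule ℂ (GAff n)) : Prop where
  le_nPlus : I ≤ nPlusAff n
  lie_mem : ∀ x ∈ borelAff n, ∀ y ∈ I, ⁅x, y⁆ ∈ I
  finite_codim : FiniteDimensional ℂ (↥(borelAff n) ⧸ I.submoduleOf (borelAff n))
  rootSpaces : ∀ α, IsPositiveRoot n α → I ⊓ rootSpace n α = ⊥ ∨ rootSpace n α ≤ I

/-- The support of `I`: the positive roots whose root spaces are contained in `I`. -/
def supp (n : ℕ) (I : Submodule ℂ (GAff n)) : Set (Module.Dual ℂ (cartanAff n)) :=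
  {α | IsPositiveRoot n α ∧ rootSpace n α ≤ I}

/-- A basic ideal: a combinatorial ideal whose support meets `D`. -/
def IsBasicIdeal (n : ℕ) (I : Submodule ℂ (GAff n)) : Prop :=
  IsCombinatorialIdeal n I ∧ (supp n I ∩ D n).Nonempty

/-! ### `B_n`-paths -/

/-- The alphabet `{r, f}`. -/
inductive Letter where
  | r
  | f
  deriving DecidableEq

/-- A `B_n`-path: a word of length `2 n` in `r` and `f`, each prefix of which contains at least
as many `r`'s as `f`'s. -/
def IsBPath (n : ℕ) (w : List Letter) : Prop :=
  w.length = 2 * n ∧ ∀ u, u <+: w → u.count Letter.f ≤ u.count Letter.r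

/-- `𝔅_n(i, j)`: the `B_n`-paths whose first and second `f` are at the positions `i < j` (counted
from `1`). Missing `f`'s are thought of as following the word immediately: a word with a single
`f`, at position `k`, belongs to `𝔅_n(k, 2n+1)`, and `r ⋯ r` belongs to `𝔅_n(2n+1, 2n+2)`. -/
def B (n i j : ℕ) : Set (List Letter) :=
  {w | IsBPath n w ∧ 1 ≤ i ∧ i < j ∧
    ∃ v, w ++ [Letter.f, Letter.f] =
      List.replicate (i - 1) Letter.r ++ Letter.f ::
        (List.replicate (j - i - 1) Letter.r ++ Letter.f :: v)}

/-! ### Admissible pairs -/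

/-- The lattice points on the path in the lower triangle given by `w`: it starts at `(-1, 0)`,
goes right by `(1, 0)` for each `r` and down by `(0, -1)` for each `f`. -/
def lowerPath (w : List Letter) : Set (ℤ × ℤ) :=
  {P | ∃ u, u <+: w ∧ P = (-1 + (u.count Letter.r : ℤ), -(u.count Letter.f : ℤ))}

/-- The lattice points on the path in the upper triangle given by `w`: it starts at `(2n, 1)`,
goes left by `(-1, 0)` for each `r` and up by `(0, 1)` for each `f`. -/
def upperPath (n : ℕ) (w : List Letter) : Set (ℤ × ℤ) :=
  {P | ∃ u, u <+: w ∧ P = (2 * (n : ℤ) - (u.count Letter.r : ℤ), 1 + (u.count Letter.f : ℤ))}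

/-- The unit box with northwest corner `(x, y)` lies to the northeast of the path `P`: some point
of the path is weakly southwest of the southwest corner `(x, y - 1)` of the box. -/
def IsNortheast (P : Set (ℤ × ℤ)) (x y : ℤ) : Prop :=
  ∃ v ∈ P, v.1 ≤ x ∧ v.2 ≤ y - 1

/-- `(p, q)` is the pair of `B_n`-paths of the ideal `I`: `p` separates the boxes of the roots of
`D₂` in the support of `I` (to its northeast) from the boxes of the other roots of `D₂`, and `q`
does the same for `D₃`. The box of `(r, s)` is the one in row `r` from the top and column `s` of
the lower triangle, with northwest corner `(s - 1, 1 - r)`; the box of `δ - (r, s)` is the one in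
row `r` from the bottom and column `2n - s` of the upper triangle, with northwest corner
`(2n - s - 1, r + 1)`. -/
structure IsPathPair (n : ℕ) (I : Submodule ℂ (GAff n)) (p q : List Letter) : Prop where
  left_isBPath : IsBPath n p
  right_isBPath : IsBPath n q
  left_separates : ∀ r s : ℕ, IsRootIndex n r s →
    (rootD2 n r s ∈ supp n I ↔ IsNortheast (lowerPath p) ((s : ℤ) - 1) (1 - (r : ℤ)))
  right_separates : ∀ r s : ℕ, IsRootIndex n r s →
    (rootD3 n r s ∈ supp n I ↔
      IsNortheast (upperPath n q) (2 * (n : ℤ) - (s : ℤ) - 1) ((r : ℤ) + 1))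

/-- `(p, q)` is admissible: it is the pair of `B_n`-paths of some basic ideal. -/
def IsAdmissible (n : ℕ) (p q : List Letter) : Prop :=
  ∃ I : Submodule ℂ (GAff n), IsBasicIdeal n I ∧ IsPathPair n I p q

end AffineB

end

/-!
In the order of the matrix positions `1, …, 2n+1` in which `𝔫₊` is strictly upper triangular, the
roots of `𝔤̃` are the nonzero weights of the matrix positions `(u, v)`, `u + v ≠ 2n+2`, of the
coefficients at `t^k`; the positions `(u, v)` and `(2n+2-v, 2n+2-u)` have the same weight. The root
`(r, s)` is at `(r, s+1)` in degree `0`, and `δ - (r, s)` at `(s+1, r)` in degree `1`. The bracket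
of root vectors at `(u, m)` and `(m, v)`, in general position, has a nonzero entry at `(u, v)`, so
the support of a combinatorial ideal is stable under such sums with positive roots; conversely the
root spaces of a set of positive roots with this stability which contains all roots of large degree
add up to a combinatorial ideal.

Adding a positive root of degree `0` moves a position up or to the right, which keeps a set of boxes
to the northeast of a lattice path. So the only interaction of the two paths of an ideal comes from
adding a root at `(u, m)` in degree `1` to the root `(m, v-1)` of `D₂`. A root of `D₂` in row `1`
and column `s` thus forces `δ - (2, 2n-s)` into the support, one in row `2` and column `s` forces
`δ - (1, 2n-s)`, and these two conditions suffice: the sum of the root spaces of the roots allowed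
by `p` in degree `0`, those allowed by `q` in degree `1` and all roots of degree at least `2` is
then an ideal with the paths `p` and `q`. In terms of words, row `1` of `D₂` is reached by the first
`f` of `p` and row `2` by the second, while `δ - (2, 2n-s)` lies to the northeast of `q` if and only
if more than `2n-s` letters `r` precede the second `f` of `q`, and `δ - (1, 2n-s)` if and only if
more than `2n-s` precede the first.
-/

noncomputable section

namespace AffineB

attribute [local instance 100] LieRing.ofAssociativeRing

variable {n : ℕ}

/-! ### Words and their lattice paths -/

section Words

open List

/-- The number of `r`'s before the `m`-th `f` of a word. As in the definition of `𝔅_n(i, j)`,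
missing `f`'s are thought of as following the word immediately. -/
def risesBefore : ℕ → List Letter → ℕ
  | 0, _ => 0
  | _ + 1, [] => 0
  | m + 1, .r :: w => risesBefore (m + 1) w + 1
  | m + 1, .f :: w => risesBefore m w

lemma exists_prefix_cons_iff {α : Type*} {c : α} {w : List α} {P : List α → Prop} :
    (∃ u, u <+: c :: w ∧ P u) ↔ P [] ∨ ∃ u, u <+: w ∧ P (c :: u) := by
  simp only [prefix_cons_iff, or_and_right, exists_or, exists_eq_left]
  grind

lemma le_risesBefore_succ_iff {m x : ℕ} {w : List Letter} :
    x ≤ risesBefore (m + 1) w ↔ ∃ u, u <+: w ∧ u.count .f ≤ m ∧ x ≤ u.count .r := by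
  induction w generalizing m x with
  | nil => simp [risesBefore]
  | cons c w ih =>
    rw [exists_prefix_cons_iff]
    cases c with
    | r =>
      rw [risesBefore, ← Nat.sub_le_iff_le_add, ih]
      have : x ≤ 0 → ∃ u, u <+: w ∧ u.count .f ≤ m ∧ x - 1 ≤ u.count .r :=
        fun hx => ⟨[], nil_prefix, by simp; omega⟩
      simpa
    | f =>
      cases m with
      | zero => simp [risesBefore]
      | succ m =>
        rw [risesBefore, ih]
        have : x ≤ 0 → ∃ u, u <+: w ∧ u.count .f ≤ m ∧ x ≤ u.count .r :=
          fun hx => ⟨[], nil_prefix, by simp; omega⟩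
        simpa

lemma exists_prefix_iff_risesBefore_le {m x : ℕ} {w : List Letter} :
    (∃ u, u <+: w ∧ m ≤ u.count .f ∧ u.count .r ≤ x) ↔
      m ≤ w.count .f ∧ risesBefore m w ≤ x := by
  induction w generalizing m x with
  | nil => cases m <;> simp [risesBefore]
  | cons c w ih =>
    cases m with
    | zero => simpa [risesBefore] using ⟨[], nil_prefix, by simp⟩
    | succ m =>
      rw [exists_prefix_cons_iff]
      cases c with
      | r =>
        cases x with
        | zero => simp [risesBefore]
        | succ x => simpa [risesBefore] using ih (m := m + 1)
      | f => simp [risesBefore, ih]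

lemma le_count_iff_risesBefore_add_le {m : ℕ} {w : List Letter} :
    m ≤ w.count .f ↔ risesBefore m w + m ≤ w.length := by
  induction w generalizing m with
  | nil => cases m <;> simp [risesBefore]
  | cons c w ih =>
    cases m with
    | zero => simp [risesBefore]
    | succ m =>
      cases c with
      | r => simp [risesBefore, ih]; omega
      | f => simp [risesBefore, ih]; omega

lemma risesBefore_le_length (m : ℕ) (w : List Letter) : risesBefore m w ≤ w.length := by
  fun_induction risesBefore m w <;> grind

lemma risesBefore_append_replicate (m k : ℕ) (w : List Letter) :
    risesBefore m (w ++ replicate k .f) = risesBefore m w := by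
  fun_induction risesBefore m w with
  | case1 => simp [risesBefore]
  | case2 m =>
    induction k generalizing m with
    | zero => rfl
    | succ k ih => cases m <;> simp_all [replicate_succ, risesBefore]
  | case3 m w ih => simpa [risesBefore] using ih
  | case4 m w ih => simpa [risesBefore] using ih

lemma risesBefore_succ_replicate_append (m k : ℕ) (w : List Letter) :
    risesBefore (m + 1) (replicate k .r ++ .f :: w) = k + risesBefore m w := by
  induction k with
  | zero => simp [risesBefore]
  | succ k ih => rw [replicate_succ, cons_append, risesBefore, ih]; omega

lemma exists_eq_replicate_append {w : List Letter} (h : .f ∈ w) :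
    ∃ k v, w = replicate k .r ++ .f :: v := by
  induction w with
  | nil => simp at h
  | cons c w ih =>
    cases c with
    | f => exact ⟨0, w, rfl⟩
    | r =>
      obtain ⟨k, v, rfl⟩ := ih (by simpa using h)
      exact ⟨k + 1, v, rfl⟩

lemma exists_append_falls_eq (w : List Letter) :
    ∃ k l v, w ++ [.f, .f] = replicate k .r ++ .f :: (replicate l .r ++ .f :: v) := by
  obtain ⟨k, t, ht⟩ := exists_eq_replicate_append (w := w ++ [.f, .f]) (by simp)
  have hf : .f ∈ t := by
    have := congrArg (count .f) ht
    simp [count_append, count_replicate] at this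
    exact count_pos_iff.1 (by omega)
  obtain ⟨l, v, rfl⟩ := exists_eq_replicate_append hf
  exact ⟨k, l, v, ht⟩

lemma risesBefore_of_append_falls_eq {k l : ℕ} {v w : List Letter}
    (h : w ++ [.f, .f] = replicate k .r ++ .f :: (replicate l .r ++ .f :: v)) :
    risesBefore 1 w = k ∧ risesBefore 2 w = k + l := by
  have hw (m : ℕ) := risesBefore_append_replicate m 2 w
  rw [← hw, ← hw, show replicate 2 Letter.f = [.f, .f] from rfl, h]
  simp only [risesBefore_succ_replicate_append, risesBefore, add_zero, and_self]

lemma mem_B_iff {i j : ℕ} {w : List Letter} :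
    w ∈ B n i j ↔ IsBPath n w ∧ risesBefore 1 w + 1 = i ∧ risesBefore 2 w + 2 = j := by
  constructor
  · rintro ⟨hw, hi, hij, v, hv⟩
    have := risesBefore_of_append_falls_eq hv
    exact ⟨hw, by omega, by omega⟩
  · rintro ⟨hw, rfl, rfl⟩
    obtain ⟨k, l, v, hv⟩ := exists_append_falls_eq w
    obtain ⟨hk, hl⟩ := risesBefore_of_append_falls_eq hv
    refine ⟨hw, by omega, by omega, v, ?_⟩
    rw [hv]
    congr <;> omega

lemma exists_mem_B_iff {k l : ℕ} {w : List Letter} :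
    (∃ i j, k ≤ i ∧ l ≤ j ∧ w ∈ B n i j) ↔
      IsBPath n w ∧ k ≤ risesBefore 1 w + 1 ∧ l ≤ risesBefore 2 w + 2 := by
  simp only [mem_B_iff]
  constructor
  · rintro ⟨_, _, hi, hj, hw, rfl, rfl⟩
    exact ⟨hw, hi, hj⟩
  · rintro ⟨hw, hi, hj⟩
    exact ⟨_, _, hi, hj, hw, rfl, rfl⟩

lemma finite_setOf_isBPath (n : ℕ) : {w | IsBPath n w}.Finite := by
  have : Finite Letter := .of_surjective (fun b : Bool => if b then Letter.r else Letter.f)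
    fun | .r => ⟨true, rfl⟩ | .f => ⟨false, rfl⟩
  exact (List.finite_length_eq Letter (2 * n)).subset fun _ hw => hw.1

lemma ncard_setOf_exists_mem_B (n k l : ℕ) :
    {q | ∃ i j, k ≤ i ∧ l ≤ j ∧ q ∈ B n i j}.ncard =
      ∑ i ∈ Finset.Icc k (2 * n + 2), ∑ j ∈ Finset.Icc l (2 * n + 2), (B n i j).ncard := by
  set S := {q | ∃ i j, k ≤ i ∧ l ≤ j ∧ q ∈ B n i j}
  have hS {q} : q ∈ S ↔ IsBPath n q ∧ k ≤ risesBefore 1 q + 1 ∧ l ≤ risesBefore 2 q + 2 :=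
    exists_mem_B_iff
  have hfin : S.Finite := (finite_setOf_isBPath n).subset fun q hq => (hS.1 hq).1
  have hmaps : Set.MapsTo (fun q => (risesBefore 1 q + 1, risesBefore 2 q + 2)) hfin.toFinset
      (Finset.Icc k (2 * n + 2) ×ˢ Finset.Icc l (2 * n + 2) : Finset (ℕ × ℕ)) := by
    intro q hq
    obtain ⟨hpath, hk, hl⟩ := hS.1 (hfin.mem_toFinset.1 hq)
    have h1 := risesBefore_le_length 1 q
    have h2 := risesBefore_le_length 2 q
    rw [hpath.1] at h1 h2
    simp only [Finset.mem_coe, Finset.mem_product, Finset.mem_Icc]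
    omega
  rw [Set.ncard_eq_toFinset_card S hfin, Finset.card_eq_sum_card_fiberwise hmaps,
    Finset.sum_product]
  refine Finset.sum_congr rfl fun i hi => Finset.sum_congr rfl fun j hj => ?_
  rw [Finset.mem_Icc] at hi hj
  rw [← Set.ncard_coe_finset]
  congr 1
  ext q
  simp only [Finset.coe_filter, hfin.mem_toFinset, hS, mem_B_iff, Prod.mk.injEq,
    Set.mem_ofPred_eq]
  grind

/-- The box in row `r` and column `s` of the lower triangle lies to the northeast of the path of
the word `p`, that is, `p` has a prefix with at least `r` letters `f` and at most `s` letters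
`r`. The row and the column range over `ℤ`, so that the condition is monotone without side
conditions. -/
def LowerBox (p : List Letter) (r s : ℤ) : Prop :=
  ∃ u, u <+: p ∧ r ≤ (u.count .f : ℤ) ∧ (u.count .r : ℤ) ≤ s

/-- The box of the root `δ - (r, s)` lies to the northeast of the path in the upper triangle of
the word `q`, that is, `q` has a prefix with less than `r` letters `f` and more than `s` letters
`r`. -/
def UpperBox (q : List Letter) (r s : ℤ) : Prop :=
  ∃ u, u <+: q ∧ (u.count .f : ℤ) < r ∧ s < (u.count .r : ℤ)

lemma isNortheast_lowerPath_iff {p : List Letter} {r s : ℤ} :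
    IsNortheast (lowerPath p) (s - 1) (1 - r) ↔ LowerBox p r s := by
  constructor
  · rintro ⟨_, ⟨u, hu, rfl⟩, h1, h2⟩
    exact ⟨u, hu, by dsimp only at h1 h2; omega, by dsimp only at h1 h2; omega⟩
  · rintro ⟨u, hu, h1, h2⟩
    exact ⟨_, ⟨u, hu, rfl⟩, by dsimp only; omega, by dsimp only; omega⟩

lemma isNortheast_upperPath_iff {q : List Letter} {r s : ℤ} :
    IsNortheast (upperPath n q) (2 * n - s - 1) (r + 1) ↔ UpperBox q r s := by
  constructor
  · rintro ⟨_, ⟨u, hu, rfl⟩, h1, h2⟩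
    exact ⟨u, hu, by dsimp only at h1 h2; omega, by dsimp only at h1 h2; omega⟩
  · rintro ⟨u, hu, h1, h2⟩
    exact ⟨_, ⟨u, hu, rfl⟩, by dsimp only; omega, by dsimp only; omega⟩

lemma LowerBox.mono {p : List Letter} {r r' s s' : ℤ} (h : LowerBox p r s) (hr : r' ≤ r)
    (hs : s ≤ s') : LowerBox p r' s' :=
  let ⟨u, hu, h1, h2⟩ := h
  ⟨u, hu, hr.trans h1, h2.trans hs⟩

lemma UpperBox.mono {q : List Letter} {r r' s s' : ℤ} (h : UpperBox q r s) (hr : r ≤ r')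
    (hs : s' ≤ s) : UpperBox q r' s' :=
  let ⟨u, hu, h1, h2⟩ := h
  ⟨u, hu, h1.trans_le hr, hs.trans_lt h2⟩

lemma lowerBox_natCast_iff {p : List Letter} {m : ℕ} (hm : m ≤ p.count .f) {s : ℤ} :
    LowerBox p m s ↔ risesBefore m p ≤ s := by
  constructor
  · rintro ⟨u, hu, h1, h2⟩
    have := (exists_prefix_iff_risesBefore_le.1 ⟨u, hu, Nat.cast_le.1 h1, le_rfl⟩).2
    omega
  · intro hs
    obtain ⟨u, hu, h1, h2⟩ := exists_prefix_iff_risesBefore_le.2 ⟨hm, le_rfl⟩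
    exact ⟨u, hu, by omega, by omega⟩

lemma upperBox_natCast_succ_iff {q : List Letter} {m s : ℕ} :
    UpperBox q (m + 1 : ℕ) s ↔ s + 1 ≤ risesBefore (m + 1) q := by
  rw [le_risesBefore_succ_iff, UpperBox]
  simp only [Nat.cast_lt, Nat.lt_succ_iff, Nat.succ_le_iff]

/-- The condition on a pair `(p, q)` of words which characterises the admissible pairs of paths:
a box of column `s` in the first row (second row) of the lower triangle which lies to the
northeast of `p` forces the box of `δ - (2, 2n-s)` (of `δ - (1, 2n-s)`) to lie to the northeast
of `q`. -/
def Compatible (n : ℕ) (p q : List Letter) : Prop :=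
  ∀ s : ℤ, 2 ≤ s → s ≤ 2 * n - 2 →
    (LowerBox p 1 s → UpperBox q 2 (2 * n - s)) ∧ (LowerBox p 2 s → UpperBox q 1 (2 * n - s))

lemma isBPath_and_compatible_iff {a b : ℕ} (ha : 3 ≤ a) (hab : a < b) (hb : b ≤ 2 * n)
    {p q : List Letter} (hp : p ∈ B n a b) :
    IsBPath n q ∧ Compatible n p q ↔
      ∃ i j, 2 * n + 4 - b ≤ i ∧ 2 * n + 4 - a ≤ j ∧ q ∈ B n i j := by
  rw [exists_mem_B_iff]
  refine and_congr_right fun _ => ?_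
  obtain ⟨⟨hlength, -⟩, rfl, rfl⟩ := mem_B_iff.1 hp
  have hcount : 2 ≤ p.count .f := le_count_iff_risesBefore_add_le.2 (by omega)
  have hlower₁ {s : ℤ} : LowerBox p 1 s ↔ risesBefore 1 p ≤ s :=
    lowerBox_natCast_iff (m := 1) (by omega)
  have hlower₂ {s : ℤ} : LowerBox p 2 s ↔ risesBefore 2 p ≤ s :=
    lowerBox_natCast_iff (m := 2) hcount
  have hupper₁ (s : ℕ) : UpperBox q 1 s ↔ s + 1 ≤ risesBefore 1 q := upperBox_natCast_succ_iff
  have hupper₂ (s : ℕ) : UpperBox q 2 s ↔ s + 1 ≤ risesBefore 2 q := upperBox_natCast_succ_iff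
  constructor
  · intro h
    have h1 := (h (risesBefore 1 p) (by omega) (by omega)).1 (hlower₁.2 le_rfl)
    have h2 := (h (risesBefore 2 p) (by omega) (by omega)).2 (hlower₂.2 le_rfl)
    replace h1 := (hupper₂ (2 * n - risesBefore 1 p)).1 (h1.mono le_rfl (by omega))
    replace h2 := (hupper₁ (2 * n - risesBefore 2 p)).1 (h2.mono le_rfl (by omega))
    omega
  · rintro ⟨hq₁, hq₂⟩ s - hs
    refine ⟨fun h => ?_, fun h => ?_⟩
    · have := hlower₁.1 h
      exact ((hupper₂ (2 * n - risesBefore 1 p)).2 (by omega)).mono le_rfl (by omega)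
    · have := hlower₂.1 h
      exact ((hupper₁ (2 * n - risesBefore 2 p)).2 (by omega)).mono le_rfl (by omega)

end Words

/-! ### The Lie algebra of type `B_n` in coordinates -/

/-- The row and column indices of the matrices in `𝔤`. -/
abbrev Idx (n : ℕ) : Type := Unit ⊕ Fin n ⊕ Fin n

/-- The index dual to `i` under the symmetric form which defines `𝔤`. -/
def Idx.dual {n : ℕ} : Idx n → Idx n
  | .inl u => .inl u
  | .inr (.inl l) => .inr (.inr l)
  | .inr (.inr l) => .inr (.inl l)

/-- The position of an index, counted from `1`, in the order in which `𝔫₊` is strictly upper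
triangular. It is an integer, since dual positions are exchanged by a subtraction. -/
def Idx.pos {n : ℕ} : Idx n → ℤ
  | .inl _ => n + 1
  | .inr (.inl l) => l + 1
  | .inr (.inr l) => 2 * n + 1 - l

/-- The nonzero entry in row `i` of the symmetric form which defines `𝔤`. -/
def Idx.form {n : ℕ} : Idx n → ℂ
  | .inl _ => 2
  | .inr _ => 1

namespace Idx

@[simp] lemma dual_dual (i : Idx n) : i.dual.dual = i := by rcases i with _ | _ | _ <;> rfl

lemma dual_injective : Function.Injective (dual (n := n)) :=
  Function.Involutive.injective dual_dual

@[simp] lemma pos_dual (i : Idx n) : i.dual.pos = 2 * n + 2 - i.pos := by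
  rcases i with _ | _ | _ <;> simp only [dual, pos] <;> ring

@[simp] lemma form_dual (i : Idx n) : i.dual.form = i.form := by
  rcases i with _ | _ | _ <;> rfl

lemma form_ne_zero (i : Idx n) : i.form ≠ 0 := by
  rcases i with _ | _ | _ <;> simp [form]

lemma one_le_pos (i : Idx n) : 1 ≤ i.pos := by
  rcases i with _ | l | l <;> simp only [pos] <;> omega

lemma pos_le (i : Idx n) : i.pos ≤ 2 * n + 1 := by
  rcases i with _ | l | l <;> simp only [pos] <;> omega

lemma pos_injective : Function.Injective (pos (n := n)) := by
  rintro (_ | i | i) (_ | j | j) h <;> simp only [pos] at h <;> first | rfl | omega | skip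
  all_goals rw [Fin.ext (a := i) (b := j) (by omega)]

lemma exists_pos_eq {u : ℤ} (h1 : 1 ≤ u) (h2 : u ≤ 2 * n + 1) : ∃ i : Idx n, i.pos = u := by
  rcases lt_trichotomy u (n + 1) with h | h | h
  · exact ⟨.inr (.inl ⟨(u - 1).toNat, by omega⟩), by simp only [pos]; omega⟩
  · exact ⟨.inl (), h.symm⟩
  · exact ⟨.inr (.inr ⟨(2 * n + 1 - u).toNat, by omega⟩), by simp only [pos]; omega⟩

lemma eq_dual_iff {i j : Idx n} : j = i.dual ↔ i.pos + j.pos = 2 * n + 2 := by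
  rw [← pos_injective.eq_iff, pos_dual]; omega

lemma eq_or_eq_dual_of_forall_odd_sub_eq {i j i' j' : Idx n} (hij : j ≠ i.dual)
    (h : ∀ c : Idx n → ℤ, (∀ m, c m.dual = -c m) → c i - c j = c i' - c j') :
    (i' = i ∧ j' = j) ∨ (i' = j.dual ∧ j' = i.dual) ∨ (i = j ∧ i' = j') := by
  have hpos := h (fun m => n + 1 - m.pos) fun m => by rw [pos_dual]; ring
  have hind (a : ℤ) := h
    (fun m => (if m.pos = a then 1 else 0) - if m.pos = 2 * n + 2 - a then 1 else 0) fun m => by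
      simp only [pos_dual]
      split_ifs <;> omega
  have hi := hind i.pos
  have hj := hind j.pos
  simp only [← pos_injective.eq_iff, pos_dual, Ne] at *
  grind

end Idx

open Idx

/-- The linear functional taking an element of `𝔤` to its matrix entry at `(i, j)`. -/
def matEntry (i j : Idx n) : G n →ₗ[ℂ] ℂ :=
  Matrix.entryLinearMap ℂ ℂ i j ∘ₗ (LieAlgebra.Orthogonal.typeB (Fin n) ℂ).toSubmodule.subtype

lemma matEntry_apply (i j : Idx n) (x : G n) : matEntry i j x = x.1 i j := rfl

lemma ext_matEntry {x y : G n} (h : ∀ i j, matEntry i j x = matEntry i j y) : x = y :=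
  Subtype.ext (Matrix.ext h)

lemma mem_typeB_iff (x : Matrix (Idx n) (Idx n) ℂ) :
    x ∈ LieAlgebra.Orthogonal.typeB (Fin n) ℂ ↔
      ∀ i j : Idx n, i.form * x i j + j.form * x j.dual i.dual = 0 := by
  have hJ (i j : Idx n) : LieAlgebra.Orthogonal.JB (Fin n) ℂ i j =
      if j = i.dual then i.form else 0 := by
    rcases i with i | i | i <;> rcases j with j | j | j <;>
      simp [LieAlgebra.Orthogonal.JB, LieAlgebra.Orthogonal.JD, Idx.dual, Idx.form,
        Matrix.one_apply, eq_comm]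
  have hright (i j : Idx n) : (x.transpose * LieAlgebra.Orthogonal.JB (Fin n) ℂ) i j =
      j.form * x j.dual i := by
    rw [Matrix.mul_apply, Finset.sum_eq_single_of_mem j.dual (Finset.mem_univ _)]
    · simp [hJ, mul_comm]
    · intro k _ hk
      rw [hJ, if_neg (fun h => hk (by rw [h, dual_dual])), mul_zero]
  have hleft (i j : Idx n) : (LieAlgebra.Orthogonal.JB (Fin n) ℂ * x) i j =
      i.form * x i.dual j := by
    rw [Matrix.mul_apply, Finset.sum_eq_single_of_mem i.dual (Finset.mem_univ _)]
    · simp [hJ]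
    · intro k _ hk
      rw [hJ, if_neg hk, zero_mul]
  rw [LieAlgebra.Orthogonal.typeB, mem_skewAdjointMatricesLieSubalgebra,
    mem_skewAdjointMatricesSubmodule, Matrix.IsSkewAdjoint, Matrix.IsAdjointPair, mul_neg,
    ← Matrix.ext_iff, (Finite.surjective_of_injective dual_injective).forall]
  refine forall₂_congr fun i j => ?_
  rw [hright, Matrix.neg_apply, hleft, dual_dual, form_dual, eq_neg_iff_add_eq_zero, add_comm]

lemma form_mul_matEntry (x : G n) (i j : Idx n) :
    i.form * matEntry i j x + j.form * matEntry j.dual i.dual x = 0 :=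
  (mem_typeB_iff x.1).1 x.2 i j

lemma matEntry_dual_dual_eq_zero_iff {x : G n} {i j : Idx n} :
    matEntry j.dual i.dual x = 0 ↔ matEntry i j x = 0 := by
  have h := form_mul_matEntry x i j
  constructor <;> intro h0 <;> simpa [h0, form_ne_zero] using h

lemma matEntry_dual_eq_zero (x : G n) (i : Idx n) : matEntry i i.dual x = 0 := by
  simpa [← two_mul, form_ne_zero] using form_mul_matEntry x i i.dual

lemma ne_dual_of_matEntry_ne_zero {x : G n} {i j : Idx n} (h : matEntry i j x ≠ 0) :
    j ≠ i.dual := by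
  rintro rfl
  exact h (matEntry_dual_eq_zero x i)

lemma matEntry_lie (i j : Idx n) (x y : G n) : matEntry i j ⁅x, y⁆ =
    ∑ m, (matEntry i m x * matEntry m j y - matEntry i m y * matEntry m j x) := by
  rw [Finset.sum_sub_distrib]
  rfl

/-- The weight of the matrix position `(i, j)`, as a functional on `𝔤` of which only the
restriction to `𝔥` matters. -/
def weight (i j : Idx n) : G n →ₗ[ℂ] ℂ := matEntry i i - matEntry j j

lemma weight_apply (i j : Idx n) (h : G n) : weight i j h = matEntry i i h - matEntry j j h := rfl

lemma matEntry_dual_dual_self (i : Idx n) : matEntry i.dual i.dual = -matEntry i i := by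
  ext h
  refine mul_left_cancel₀ (form_ne_zero i) ?_
  rw [LinearMap.neg_apply]
  linear_combination form_mul_matEntry h i i

lemma weight_dual_dual (i j : Idx n) : weight j.dual i.dual = weight i j := by
  rw [weight, weight, matEntry_dual_dual_self, matEntry_dual_dual_self]
  abel

lemma matEntry_cartan_lie {h : G n} (hh : h ∈ cartan n) (x : G n) (i j : Idx n) :
    matEntry i j ⁅h, x⁆ = weight i j h * matEntry i j x := by
  have hoff {k l : Idx n} (hkl : k ≠ l) : matEntry k l h = 0 := hh hkl
  rw [matEntry_lie, Finset.sum_sub_distrib, Finset.sum_eq_single_of_mem i (Finset.mem_univ i),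
    Finset.sum_eq_single_of_mem j (Finset.mem_univ j), weight_apply]
  · ring
  · intro m _ hm; rw [hoff hm, mul_zero]
  · intro m _ hm; rw [hoff hm.symm, zero_mul]

/-- The diagonal element of `𝔥` with entries `c i`. -/
def cartanElt (c : Idx n → ℤ) (hc : ∀ i, c i.dual = -c i) : G n :=
  ⟨Matrix.diagonal fun i => (c i : ℂ), (mem_typeB_iff _).2 fun i j => by
    by_cases h : i = j
    · subst h; simp [hc]
    · rw [Matrix.diagonal_apply_ne _ h,
        Matrix.diagonal_apply_ne _ fun h' => h (dual_injective h').symm]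
      simp⟩

lemma cartanElt_mem (c : Idx n → ℤ) (hc) : cartanElt c hc ∈ cartan n := Matrix.isDiag_diagonal _

lemma weight_cartanElt (c : Idx n → ℤ) (hc) (i j : Idx n) :
    weight i j (cartanElt c hc) = (c i - c j : ℤ) := by
  simp [weight_apply, matEntry_apply, cartanElt]

lemma eq_or_eq_dual_of_weight_eq {i j i' j' : Idx n} (hij : j ≠ i.dual)
    (h : ∀ x ∈ cartan n, weight i j x = weight i' j' x) :
    (i' = i ∧ j' = j) ∨ (i' = j.dual ∧ j' = i.dual) ∨ (i = j ∧ i' = j') := by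
  refine eq_or_eq_dual_of_forall_odd_sub_eq hij fun c hc => ?_
  have := h _ (cartanElt_mem c hc)
  rwa [weight_cartanElt, weight_cartanElt, Int.cast_inj] at this

/-- The root vector of `𝔤` supported at the positions `(i, j)` and `(j*, i*)`. -/
def rootVec (i j : Idx n) : G n :=
  ⟨Matrix.single i j j.form - Matrix.single j.dual i.dual i.form, (mem_typeB_iff _).2 fun k l => by
    have : (j.dual = k ∧ i.dual = l) ↔ (i = l.dual ∧ j = k.dual) := by
      constructor <;> rintro ⟨rfl, rfl⟩ <;> simp
    simp only [Matrix.sub_apply, Matrix.single_apply, this, dual_injective.eq_iff]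
    grind [form_dual]⟩

lemma matEntry_rootVec (i j k l : Idx n) : matEntry k l (rootVec i j) =
    (if i = k ∧ j = l then j.form else 0) - if j.dual = k ∧ i.dual = l then i.form else 0 := by
  simp [matEntry_apply, rootVec, Matrix.single_apply]

lemma matEntry_rootVec_self {i j : Idx n} (h : j ≠ i.dual) :
    matEntry i j (rootVec i j) = j.form := by
  rw [matEntry_rootVec, if_pos ⟨rfl, rfl⟩, if_neg fun h' => h h'.2.symm, sub_zero]

lemma of_matEntry_rootVec_ne_zero {i j k l : Idx n} (h : matEntry k l (rootVec i j) ≠ 0) :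
    (k = i ∧ l = j) ∨ (k = j.dual ∧ l = i.dual) := by
  rw [matEntry_rootVec] at h
  grind

lemma rootVec_dual (i : Idx n) : rootVec i i.dual = 0 :=
  ext_matEntry fun k l => by simp [matEntry_rootVec]

lemma two_smul_eq_sum_rootVec (x : G n) :
    (2 : ℂ) • x = ∑ i, ∑ j, (matEntry i j x * j.form⁻¹) • rootVec i j := by
  refine ext_matEntry fun k l => ?_
  have hsum (f : Idx n → Idx n → ℂ) (k l : Idx n) :
      ∑ i, ∑ j, (if i = k ∧ j = l then f i j else 0) = f k l := by
    simp [ite_and]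
  have hterm (i j : Idx n) :
      matEntry k l ((matEntry i j x * j.form⁻¹) • rootVec i j) =
        (if i = k ∧ j = l then matEntry i j x else 0) +
          if i = l.dual ∧ j = k.dual then matEntry j.dual i.dual x else 0 := by
    have h1 : i.form * matEntry i j x * j.form⁻¹ = -matEntry j.dual i.dual x := by
      rw [eq_neg_of_add_eq_zero_left (form_mul_matEntry x i j)]
      field_simp [form_ne_zero j]
    have h2 : (j.dual = k ∧ i.dual = l) ↔ i = l.dual ∧ j = k.dual := by
      constructor <;> rintro ⟨rfl, rfl⟩ <;> simp
    simp only [map_smul, smul_eq_mul, matEntry_rootVec, h2]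
    have hj := mul_inv_cancel₀ (form_ne_zero j)
    split_ifs <;> grind
  simp only [map_sum, hterm, Finset.sum_add_distrib, hsum, dual_dual, map_smul, smul_eq_mul,
    two_mul]

lemma rootVec_mem_finRootSpace (i j : Idx n) : rootVec i j ∈ finRootSpace n (weight i j) := by
  refine fun h hh => ext_matEntry fun k l => ?_
  rw [matEntry_cartan_lie hh, map_smul, smul_eq_mul]
  by_cases h0 : matEntry k l (rootVec i j) = 0
  · rw [h0, mul_zero, mul_zero]
  · rcases of_matEntry_rootVec_ne_zero h0 with ⟨rfl, rfl⟩ | ⟨rfl, rfl⟩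
    · rfl
    · rw [weight_dual_dual]

lemma eps_eq_matEntry {r : ℕ} {i : Idx n} (hi : i.pos = r) (hr : r ≤ n + 1) :
    eps n r = matEntry i i := by
  have h1 := one_le_pos i
  rcases i with u | l | l <;> simp only [pos] at hi h1
  · rw [eps, dif_neg (by omega)]
    ext h
    exact (matEntry_dual_eq_zero h (.inl u)).symm
  · obtain rfl : r = l + 1 := by omega
    rw [eps, dif_pos (by omega)]
    rfl
  · omega

lemma sum_simpleRoot {r s : ℕ} (h : r ≤ s + 1) :
    ∑ i ∈ Finset.Icc r s, simpleRoot n i = eps n r - eps n (s + 1) := by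
  rw [← neg_sub, ← Finset.sum_Ico_sub (eps n) h, Finset.Ico_add_one_right_eq_Icc,
    ← Finset.sum_neg_distrib]
  simp only [simpleRoot, neg_sub]

lemma posRoot_eq_weight {r s : ℕ} (hrs : IsRootIndex n r s) {i j : Idx n} (hi : i.pos = r)
    (hj : j.pos = s + 1) : posRoot n r s = weight i j := by
  obtain ⟨h1, h2, h3⟩ := hrs
  have hi' := eps_eq_matEntry hi (by omega)
  rw [posRoot, weight]
  rcases Nat.lt_or_ge n s with hs | hs
  · have hj' := eps_eq_matEntry (r := 2 * n + 1 - s) (i := j.dual) (by rw [pos_dual]; omega)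
      (by omega)
    rw [matEntry_dual_dual_self] at hj'
    rw [min_eq_right hs.le, sum_simpleRoot (by omega), sum_simpleRoot (by omega), hi', hj']
    have hmid : eps n (n + 1) = 0 := by simp [eps]
    rw [hmid]
    abel
  · rw [min_eq_left hs, sum_simpleRoot (by omega), Finset.Icc_eq_empty (by omega),
      Finset.sum_empty, add_zero, hi', eps_eq_matEntry (r := s + 1) (i := j) hj (by omega)]

lemma IsRootIndex.exists_idx {r s : ℕ} (hrs : IsRootIndex n r s) :
    ∃ i j : Idx n, i.pos = r ∧ j.pos = s + 1 := by
  obtain ⟨h1, -, h3⟩ := hrs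
  obtain ⟨i, hi⟩ := exists_pos_eq (n := n) (u := r) (by omega) (by omega)
  obtain ⟨j, hj⟩ := exists_pos_eq (n := n) (u := s + 1) (by omega) (by omega)
  exact ⟨i, j, hi, hj⟩

lemma exists_posRoot_eq_weight {i j : Idx n} (hij : i.pos < j.pos) (hd : j ≠ i.dual) :
    ∃ r s, IsRootIndex n r s ∧ posRoot n r s = weight i j := by
  wlog h : i.pos + j.pos < 2 * n + 2 generalizing i j
  · rw [Ne, eq_dual_iff] at hd
    rw [← weight_dual_dual]
    refine this ?_ ?_ ?_
    all_goals simp only [Ne, eq_dual_iff, pos_dual]; omega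
  · have hi := one_le_pos i
    have hrs : IsRootIndex n i.pos.toNat (j.pos - 1).toNat := ⟨by omega, by omega, by omega⟩
    exact ⟨_, _, hrs, posRoot_eq_weight hrs (by omega) (by omega)⟩

lemma rootVec_mem_nPlus {i j : Idx n} (hij : i.pos < j.pos) : rootVec i j ∈ nPlus n := by
  by_cases hd : j = i.dual
  · rw [hd, rootVec_dual]
    exact zero_mem _
  · obtain ⟨r, s, hrs, h⟩ := exists_posRoot_eq_weight hij hd
    exact Submodule.mem_iSup_of_mem r (Submodule.mem_iSup_of_mem s
      (Submodule.mem_iSup_of_mem hrs (h ▸ rootVec_mem_finRootSpace i j)))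

lemma pos_lt_pos_of_mem_finRootSpace {r s : ℕ} (hrs : IsRootIndex n r s) {x : G n}
    (hx : x ∈ finRootSpace n (posRoot n r s)) {i j : Idx n} (h0 : matEntry i j x ≠ 0) :
    i.pos < j.pos := by
  obtain ⟨k, l, hk, hl⟩ := hrs.exists_idx
  have hodd (m : Idx n) : n + 1 - m.dual.pos = -(n + 1 - m.pos) := by rw [pos_dual]; ring
  have h := congrArg (matEntry i j) (hx _ (cartanElt_mem (fun m => n + 1 - m.pos) hodd))
  rw [matEntry_cartan_lie (cartanElt_mem _ hodd), map_smul, smul_eq_mul,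
    mul_left_inj' h0, posRoot_eq_weight hrs hk hl, weight_cartanElt, weight_cartanElt,
    Int.cast_inj] at h
  have := hrs.2.1
  omega

lemma mem_nPlus_iff {x : G n} :
    x ∈ nPlus n ↔ ∀ i j, matEntry i j x ≠ 0 → i.pos < j.pos := by
  constructor
  · intro hx i j h0
    by_contra hij
    have hle : nPlus n ≤ LinearMap.ker (matEntry i j) :=
      iSup_le fun r => iSup_le fun s => iSup_le fun hrs y hy => by
        by_contra hy0
        exact hij (pos_lt_pos_of_mem_finRootSpace hrs hy hy0)
    exact h0 (hle hx)
  · intro h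
    rw [← Submodule.smul_mem_iff _ (two_ne_zero (α := ℂ)), two_smul_eq_sum_rootVec]
    refine sum_mem fun i _ => sum_mem fun j _ => ?_
    by_cases h0 : matEntry i j x = 0
    · simp [h0]
    · exact Submodule.smul_mem _ _ (rootVec_mem_nPlus (h i j h0))

/-! ### The affine algebra in coordinates -/

/-- The component in the loop algebra of an element of `𝔤̃`. -/
def loopPart : GAff n →ₗ[ℂ] Loop n where
  toFun z := ((LieAlgebra.ofProd (cocycle n)).symm z.left).1
  map_add' _ _ := rfl
  map_smul' _ _ := rfl

/-- The coefficient at `t^k` of an element of `𝔤̃`. -/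
def coef (k : ℤ) : GAff n →ₗ[ℂ] G n :=
  Finsupp.lapply k ∘ₗ (LieAlgebra.LoopAlgebra.toFinsupp ℂ ℤ (G n)).toLinearMap ∘ₗ loopPart

/-- The coefficient of `c` in an element of `𝔤̃`. -/
def centCoef : GAff n →ₗ[ℂ] ℂ where
  toFun z := TrivialLieModule.equiv ℂ (Loop n) ℂ ((LieAlgebra.ofProd (cocycle n)).symm z.left).2
  map_add' _ _ := rfl
  map_smul' _ _ := rfl

/-- The coefficient of `d` in an element of `𝔤̃`. -/
def degCoef : GAff n →ₗ[ℂ] ℂ where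
  toFun z := z.right
  map_add' _ _ := rfl
  map_smul' _ _ := rfl

/-- The matrix entry at `(i, j)` of the coefficient at `t^k` of an element of `𝔤̃`. -/
def entry (k : ℤ) (i j : Idx n) : GAff n →ₗ[ℂ] ℂ := matEntry i j ∘ₗ coef k

lemma entry_apply (k : ℤ) (i j : Idx n) (z : GAff n) :
    entry k i j z = matEntry i j (coef k z) := rfl

lemma ext_coef {z w : GAff n} (hc : centCoef z = centCoef w) (hd : degCoef z = degCoef w)
    (h : ∀ k, coef k z = coef k w) : z = w := by
  obtain ⟨z, a⟩ := z
  obtain ⟨w, b⟩ := w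
  have hleft : z = w := (LieAlgebra.ofProd (cocycle n)).symm.injective <|
    Prod.ext ((LieAlgebra.LoopAlgebra.toFinsupp ℂ ℤ (G n)).injective (Finsupp.ext h))
      ((TrivialLieModule.equiv ℂ (Loop n) ℂ).injective hc)
  have hright : a = b := hd
  rw [hleft, hright]

lemma ext_entry {z w : GAff n} (hc : centCoef z = centCoef w) (hd : degCoef z = degCoef w)
    (h : ∀ k i j, entry k i j z = entry k i j w) : z = w :=
  ext_coef hc hd fun k => ext_matEntry (h k)

lemma coef_mono (x : G n) (k l : ℤ) : coef l (mono n x k) = if k = l then x else 0 := by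
  change LieAlgebra.LoopAlgebra.toFinsupp ℂ ℤ (G n) (.single k 1 ⊗ₜ x) l = _
  rw [LieAlgebra.LoopAlgebra.toFinsupp_single_tmul, Finsupp.single_apply]

lemma centCoef_mono (x : G n) (k : ℤ) : centCoef (mono n x k) = 0 := rfl

lemma degCoef_mono (x : G n) (k : ℤ) : degCoef (mono n x k) = 0 := rfl

lemma coef_cElt (k : ℤ) : coef k (cElt n) = 0 := by
  change LieAlgebra.LoopAlgebra.toFinsupp ℂ ℤ (G n) 0 k = 0
  rw [map_zero, Finsupp.zero_apply]

lemma coef_dElt (k : ℤ) : coef k (dElt n) = 0 := by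
  change LieAlgebra.LoopAlgebra.toFinsupp ℂ ℤ (G n) 0 k = 0
  rw [map_zero, Finsupp.zero_apply]

lemma degCoef_cElt : degCoef (cElt n) = 0 := rfl

lemma degCoef_dElt : degCoef (dElt n) = 1 := rfl

lemma eq_sum_mono {z : GAff n} (hc : centCoef z = 0) (hd : degCoef z = 0) :
    z = ∑ k ∈ (LieAlgebra.LoopAlgebra.toFinsupp ℂ ℤ (G n) (loopPart z)).support,
      mono n (coef k z) k := by
  refine ext_coef ?_ ?_ fun l => ?_
  · simp only [map_sum, centCoef_mono, Finset.sum_const_zero, hc]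
  · simp only [map_sum, degCoef_mono, Finset.sum_const_zero, hd]
  · simp only [map_sum, coef_mono, Finset.sum_ite_eq']
    split_ifs with h
    · rfl
    · exact Finsupp.notMem_support_iff.1 h

lemma toFinsupp_single_tmul_lie (x : G n) (k l : ℤ) (y : Loop n) :
    LieAlgebra.LoopAlgebra.toFinsupp ℂ ℤ (G n)
      ⁅((AddMonoidAlgebra.single k 1 : AddMonoidAlgebra ℂ ℤ) ⊗ₜ[ℂ] x : Loop n), y⁆ l =
      ⁅x, LieAlgebra.LoopAlgebra.toFinsupp ℂ ℤ (G n) y (l - k)⁆ := by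
  induction y using loop_induction with
  | add y y' hy hy' =>
    have h (z : Loop n) : ⁅z, y + y'⁆ = ⁅z, y⁆ + ⁅z, y'⁆ := lie_add z y y'
    rw [h, map_add, map_add, Finsupp.add_apply, Finsupp.add_apply, lie_add, hy, hy']
  | tmul m y =>
    rw [LieAlgebra.ExtendScalars.bracket_tmul, AddMonoidAlgebra.single_mul_single, mul_one,
      LieAlgebra.LoopAlgebra.toFinsupp_single_tmul, LieAlgebra.LoopAlgebra.toFinsupp_single_tmul,
      Finsupp.single_apply, Finsupp.single_apply]
    by_cases h : k + m = l
    · rw [if_pos h, if_pos (by omega)]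
    · rw [if_neg h, if_neg (by omega), lie_zero]

lemma toFinsupp_loopDegree (y : Loop n) (l : ℤ) :
    LieAlgebra.LoopAlgebra.toFinsupp ℂ ℤ (G n) (loopDegree n y) l =
      (l : ℂ) • LieAlgebra.LoopAlgebra.toFinsupp ℂ ℤ (G n) y l := by
  induction y using loop_induction with
  | add y y' hy hy' => simp only [map_add, Finsupp.add_apply, hy, hy', smul_add]
  | tmul m y =>
    rw [loopDegree_tmul, map_smul, Finsupp.smul_apply,
      LieAlgebra.LoopAlgebra.toFinsupp_single_tmul, Finsupp.single_apply]
    split_ifs with h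
    · rw [h]
    · simp

lemma cocycle_single_tmul (x : G n) (k : ℤ) (y : Loop n) :
    TrivialLieModule.equiv ℂ (Loop n) ℂ
      ((cocycle n).1 ((AddMonoidAlgebra.single k 1 : AddMonoidAlgebra ℂ ℤ) ⊗ₜ[ℂ] x) y) =
      k * killingForm ℂ (G n) x (LieAlgebra.LoopAlgebra.toFinsupp ℂ ℤ (G n) y (-k)) := by
  induction y using loop_induction with
  | add y y' hy hy' => simp only [map_add, Finsupp.add_apply, hy, hy', mul_add]
  | tmul m y =>
    rw [cocycle_tmul, LieAlgebra.LoopAlgebra.toFinsupp_single_tmul, Finsupp.single_apply,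
      LinearEquiv.apply_symm_apply]
    by_cases h : k + m = 0
    · rw [if_pos h, if_pos (by omega)]
    · rw [if_neg h, if_neg (by omega), map_zero, mul_zero]

lemma loopPart_lie (z w : GAff n) :
    loopPart ⁅z, w⁆ = ⁅loopPart z, loopPart w⁆ + degCoef z • loopDegree n (loopPart w) -
      degCoef w • loopDegree n (loopPart z) := rfl

lemma centCoef_lie (z w : GAff n) :
    centCoef ⁅z, w⁆ =
      TrivialLieModule.equiv ℂ (Loop n) ℂ ((cocycle n).1 (loopPart z) (loopPart w)) := by
  change TrivialLieModule.equiv ℂ (Loop n) ℂ ((cocycle n).1 (loopPart z) (loopPart w) +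
    ⁅loopPart z, ((LieAlgebra.ofProd (cocycle n)).symm w.left).2⁆ -
    ⁅loopPart w, ((LieAlgebra.ofProd (cocycle n)).symm z.left).2⁆ +
    degCoef z • 0 - degCoef w • 0) = _
  rw [LieModule.IsTrivial.trivial, LieModule.IsTrivial.trivial]
  simp only [add_zero, sub_zero, smul_zero]

lemma degCoef_lie (z w : GAff n) : degCoef ⁅z, w⁆ = 0 := by
  change ⁅z.right, w.right⁆ = 0
  rw [LieRing.of_associative_ring_bracket, mul_comm, sub_self]

lemma coef_lie_of_loopPart_eq_zero {w : GAff n} (hw : loopPart w = 0) (l : ℤ) (z : GAff n) :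
    coef l ⁅w, z⁆ = (degCoef w * l) • coef l z := by
  have h : ⁅(0 : Loop n), loopPart z⁆ = 0 := zero_lie (loopPart z)
  change LieAlgebra.LoopAlgebra.toFinsupp ℂ ℤ (G n) (loopPart ⁅w, z⁆) l = _
  rw [loopPart_lie, hw, map_zero, smul_zero, sub_zero, h, zero_add, map_smul,
    Finsupp.smul_apply, toFinsupp_loopDegree, smul_smul]
  rfl

lemma coef_mono_lie (x : G n) (k l : ℤ) (z : GAff n) :
    coef l ⁅mono n x k, z⁆ =
      ⁅x, coef (l - k) z⁆ - (degCoef z * l) • coef l (mono n x k) := by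
  change LieAlgebra.LoopAlgebra.toFinsupp ℂ ℤ (G n) (loopPart ⁅mono n x k, z⁆) l = _
  rw [loopPart_lie, degCoef_mono, zero_smul, add_zero, map_sub, Finsupp.sub_apply,
    map_smul, Finsupp.smul_apply, toFinsupp_loopDegree, mul_smul]
  exact congrArg (· - _) (toFinsupp_single_tmul_lie x k l (loopPart z))

lemma centCoef_lie_of_loopPart_eq_zero {w : GAff n} (hw : loopPart w = 0) (z : GAff n) :
    centCoef ⁅w, z⁆ = 0 := by
  rw [centCoef_lie, hw, map_zero, LinearMap.zero_apply, map_zero]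

lemma centCoef_mono_lie (x : G n) (k : ℤ) (z : GAff n) :
    centCoef ⁅mono n x k, z⁆ = k * killingForm ℂ (G n) x (coef (-k) z) := by
  rw [centCoef_lie]
  exact cocycle_single_tmul x k (loopPart z)

lemma entry_mono_lie (x : G n) {z : GAff n} (hz : degCoef z = 0) (k l : ℤ) (i j : Idx n) :
    entry l i j ⁅mono n x k, z⁆ = ∑ m, (matEntry i m x * entry (l - k) m j z -
      entry (l - k) i m z * matEntry m j x) := by
  rw [entry_apply, coef_mono_lie, hz, zero_mul, zero_smul, sub_zero, matEntry_lie]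
  simp only [entry_apply, mul_comm]

/-! ### Weights -/

/-- The weight of `𝔥̃` at the matrix position `(i, j)` of the coefficient at `t^k`. The roots of
`𝔤̃` are the nonzero weights of the positions off the antidiagonal. -/
def affWeight (k : ℤ) (i j : Idx n) : Module.Dual ℂ (cartanAff n) :=
  (weight i j ∘ₗ coef 0 + (k : ℂ) • degCoef).domRestrict (cartanAff n)

lemma affWeight_apply (k : ℤ) (i j : Idx n) (h : cartanAff n) :
    affWeight k i j h = weight i j (coef 0 h.1) + k * degCoef h.1 := rfl

lemma affWeight_dual_dual (k : ℤ) (i j : Idx n) : affWeight k j.dual i.dual = affWeight k i j := by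
  rw [affWeight, weight_dual_dual, affWeight]

lemma rootD2_eq_affWeight {r s : ℕ} (hrs : IsRootIndex n r s) {i j : Idx n} (hi : i.pos = r)
    (hj : j.pos = s + 1) : rootD2 n r s = affWeight 0 i j := by
  rw [rootD2, affWeight, posRoot_eq_weight hrs hi hj, Int.cast_zero, zero_smul, add_zero]
  rfl

lemma delta_eq_affWeight (i : Idx n) : delta n = affWeight 1 i i := by
  rw [affWeight, weight, sub_self, LinearMap.zero_comp, zero_add, Int.cast_one, one_smul]
  rfl

lemma rootD3_eq_affWeight {r s : ℕ} (hrs : IsRootIndex n r s) {i j : Idx n} (hi : i.pos = r)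
    (hj : j.pos = s + 1) : rootD3 n r s = affWeight 1 j i := by
  rw [rootD3, rootD2_eq_affWeight hrs hi hj, delta_eq_affWeight i]
  ext h
  simp only [LinearMap.sub_apply, affWeight_apply, weight_apply, Int.cast_one, Int.cast_zero]
  ring

lemma centCoef_cartanAff_lie {h : GAff n} (hh : h ∈ cartanAff n) (z : GAff n) :
    centCoef ⁅h, z⁆ = 0 := by
  induction hh using Submodule.span_induction with
  | mem h hh =>
    rcases hh with (rfl | rfl) | ⟨x, -, rfl⟩
    · exact centCoef_lie_of_loopPart_eq_zero rfl z
    · exact centCoef_lie_of_loopPart_eq_zero rfl z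
    · rw [centCoef_mono_lie, Int.cast_zero, zero_mul]
  | zero => rw [zero_lie, map_zero]
  | add x y _ _ hx hy => rw [add_lie, map_add, hx, hy, add_zero]
  | smul a x _ hx => rw [smul_lie, map_smul, hx, smul_zero]

lemma entry_cartanAff_lie (h : cartanAff n) (z : GAff n) (k : ℤ) (i j : Idx n) :
    entry k i j ⁅(h : GAff n), z⁆ = affWeight k i j h * entry k i j z := by
  obtain ⟨h, hh⟩ := h
  rw [affWeight_apply]
  dsimp only
  induction hh using Submodule.span_induction with
  | mem h hh =>
    rcases hh with (rfl | rfl) | ⟨x, hx, rfl⟩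
    · rw [entry_apply, coef_lie_of_loopPart_eq_zero rfl]
      simp [coef_cElt, degCoef_cElt]
    · rw [entry_apply, coef_lie_of_loopPart_eq_zero rfl]
      simp [coef_dElt, degCoef_dElt, entry_apply]
    · rw [entry_apply, coef_mono_lie, coef_mono, coef_mono, if_pos rfl, degCoef_mono, mul_zero,
        add_zero, sub_zero, map_sub, matEntry_cartan_lie hx, entry_apply, sub_eq_self]
      split_ifs with hk
      · simp [← hk]
      · simp
  | zero => simp only [zero_lie, map_zero, mul_zero, add_zero, zero_mul]
  | add x y _ _ hx hy =>
    rw [add_lie, map_add, hx, hy, map_add, map_add, map_add]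
    ring
  | smul a x _ hx =>
    rw [smul_lie, map_smul, hx, map_smul, map_smul, map_smul]
    simp only [smul_eq_mul]
    ring

lemma eq_of_affWeight_eq {k k' : ℤ} {i j i' j' : Idx n} (hij : j ≠ i.dual)
    (h : affWeight k i j = affWeight k' i' j') : k' = k ∧
      ((i' = i ∧ j' = j) ∨ (i' = j.dual ∧ j' = i.dual) ∨ (i = j ∧ i' = j')) := by
  constructor
  · have hd : dElt n ∈ cartanAff n := Submodule.subset_span (by simp)
    have := LinearMap.congr_fun h ⟨_, hd⟩
    simpa [affWeight_apply, coef_dElt, degCoef_dElt, eq_comm] using this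
  · refine eq_or_eq_dual_of_weight_eq hij fun x hx => ?_
    have hx : mono n x 0 ∈ cartanAff n := Submodule.subset_span (Or.inr ⟨x, hx, rfl⟩)
    have := LinearMap.congr_fun h ⟨_, hx⟩
    simpa [affWeight_apply, coef_mono, degCoef_mono] using this

/-! ### Root spaces and sums of root spaces -/

/-- The sum of the root spaces of the `α ∈ Φ`, for a set `Φ` of nonzero weights: the elements of
`𝔤̃` without `c`- and `d`-component whose entries vanish at the positions of weight outside `Φ`. -/
def rootSum (Φ : Set (Module.Dual ℂ (cartanAff n))) : Submodule ℂ (GAff n) :=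
  LinearMap.ker centCoef ⊓ LinearMap.ker degCoef ⊓
    ⨅ (k : ℤ) (i : Idx n) (j : Idx n) (_ : affWeight k i j ∉ Φ), LinearMap.ker (entry k i j)

variable {Φ : Set (Module.Dual ℂ (cartanAff n))} {α : Module.Dual ℂ (cartanAff n)}

lemma mem_rootSum_iff {z : GAff n} : z ∈ rootSum Φ ↔ centCoef z = 0 ∧ degCoef z = 0 ∧
    ∀ k i j, entry k i j z ≠ 0 → affWeight k i j ∈ Φ := by
  simp only [rootSum, Submodule.mem_inf, Submodule.mem_iInf, LinearMap.mem_ker, and_assoc]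
  exact and_congr_right' (and_congr_right' (forall₃_congr fun _ _ _ => not_imp_comm))

lemma rootSum_mono {Ψ : Set (Module.Dual ℂ (cartanAff n))} (h : Φ ⊆ Ψ) :
    rootSum Φ ≤ rootSum Ψ := by
  intro z hz
  obtain ⟨hc, hd, he⟩ := mem_rootSum_iff.1 hz
  exact mem_rootSum_iff.2 ⟨hc, hd, fun k i j h0 => h (he k i j h0)⟩

lemma rootSum_empty : rootSum (∅ : Set (Module.Dual ℂ (cartanAff n))) = ⊥ := by
  refine (Submodule.eq_bot_iff _).2 fun z hz => ?_
  obtain ⟨hc, hd, he⟩ := mem_rootSum_iff.1 hz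
  refine ext_entry (by rw [hc, map_zero]) (by rw [hd, map_zero]) fun k i j => ?_
  rw [map_zero]
  exact of_not_not (he k i j)

lemma rootSpace_eq_rootSum (hα : α ≠ 0) : rootSpace n α = rootSum {α} := by
  ext z
  rw [mem_rootSum_iff]
  constructor
  · intro hz
    obtain ⟨h, hh⟩ : ∃ h, α h ≠ 0 := by simpa [DFunLike.ext_iff] using hα
    refine ⟨?_, ?_, fun k i j h0 => LinearMap.ext fun h' => mul_right_cancel₀ h0 ?_⟩
    · have := congrArg centCoef (hz h)
      rw [centCoef_cartanAff_lie h.2, map_smul, smul_eq_mul, eq_comm] at this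
      exact (mul_eq_zero.1 this).resolve_left hh
    · have := congrArg degCoef (hz h)
      rw [degCoef_lie, map_smul, smul_eq_mul, eq_comm] at this
      exact (mul_eq_zero.1 this).resolve_left hh
    · rw [← entry_cartanAff_lie, hz h', map_smul, smul_eq_mul]
  · rintro ⟨hc, hd, he⟩ h
    refine ext_entry ?_ ?_ fun k i j => ?_
    · rw [centCoef_cartanAff_lie h.2, map_smul, hc, smul_zero]
    · rw [degCoef_lie, map_smul, hd, smul_zero]
    · rw [entry_cartanAff_lie, map_smul, smul_eq_mul]
      by_cases h0 : entry k i j z = 0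
      · rw [h0, mul_zero, mul_zero]
      · rw [he k i j h0]

lemma rootSum_inf_rootSpace_eq_bot (hα : α ≠ 0) (h : α ∉ Φ) : rootSum Φ ⊓ rootSpace n α = ⊥ := by
  rw [rootSpace_eq_rootSum hα, eq_bot_iff, ← rootSum_empty]
  rintro z ⟨hΦ, hz⟩
  obtain ⟨hc, hd, he⟩ := mem_rootSum_iff.1 hz
  refine mem_rootSum_iff.2 ⟨hc, hd, fun k i j h0 => h ?_⟩
  rw [← he k i j h0]
  exact (mem_rootSum_iff.1 hΦ).2.2 k i j h0

lemma entry_mono (x : G n) (k l : ℤ) (i j : Idx n) :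
    entry l i j (mono n x k) = if k = l then matEntry i j x else 0 := by
  rw [entry_apply, coef_mono, apply_ite (matEntry i j), map_zero]

lemma entry_mono_rootVec_ne_zero {i j : Idx n} (hij : j ≠ i.dual) (k : ℤ) :
    entry k i j (mono n (rootVec i j) k) ≠ 0 := by
  rw [entry_mono, if_pos rfl, matEntry_rootVec_self hij]
  exact form_ne_zero j

lemma mono_rootVec_mem_rootSpace (k : ℤ) (i j : Idx n) :
    mono n (rootVec i j) k ∈ rootSpace n (affWeight k i j) := by
  refine fun h => ext_entry ?_ ?_ fun l i' j' => ?_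
  · rw [centCoef_cartanAff_lie h.2, map_smul, centCoef_mono, smul_zero]
  · rw [degCoef_lie, map_smul, degCoef_mono, smul_zero]
  · rw [entry_cartanAff_lie, map_smul, smul_eq_mul, entry_mono]
    split_ifs with hkl
    · subst hkl
      by_cases h0 : matEntry i' j' (rootVec i j) = 0
      · rw [h0, mul_zero, mul_zero]
      · rcases of_matEntry_rootVec_ne_zero h0 with ⟨rfl, rfl⟩ | ⟨rfl, rfl⟩
        · rfl
        · rw [affWeight_dual_dual]
    · rw [mul_zero, mul_zero]

lemma mem_nPlusAff_iff {z : GAff n} : z ∈ nPlusAff n ↔ centCoef z = 0 ∧ degCoef z = 0 ∧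
    ∀ k i j, entry k i j z ≠ 0 → 0 < k ∨ k = 0 ∧ i.pos < j.pos := by
  constructor
  · intro hz
    refine ⟨?_, ?_, fun k i j h0 => ?_⟩
    · refine (Submodule.span_le (p := LinearMap.ker centCoef)).2 ?_ hz
      rintro _ (⟨x, -, rfl⟩ | ⟨x, k, -, rfl⟩) <;> exact centCoef_mono x _
    · refine (Submodule.span_le (p := LinearMap.ker degCoef)).2 ?_ hz
      rintro _ (⟨x, -, rfl⟩ | ⟨x, k, -, rfl⟩) <;> exact degCoef_mono x _
    · by_contra hk
      refine h0 ((Submodule.span_le (p := LinearMap.ker (entry k i j))).2 ?_ hz)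
      rintro _ (⟨x, hx, rfl⟩ | ⟨x, l, hl, rfl⟩)
      · refine of_not_not fun h => ?_
        rw [SetLike.mem_coe, LinearMap.mem_ker, entry_mono] at h
        obtain ⟨rfl, hne⟩ := ite_ne_right_iff.1 h
        exact hk (Or.inr ⟨rfl, mem_nPlus_iff.1 hx i j hne⟩)
      · refine (entry_mono x l k i j).trans (if_neg ?_)
        rintro rfl
        exact hk (Or.inl hl)
  · rintro ⟨hc, hd, he⟩
    rw [eq_sum_mono hc hd]
    refine sum_mem fun k hk => ?_
    rcases lt_trichotomy k 0 with hneg | rfl | hpos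
    · refine absurd (ext_matEntry fun i j => ?_) (Finsupp.mem_support_iff.1 hk)
      rw [map_zero]
      by_contra h0
      rcases he k i j h0 with h | h <;> omega
    · refine Submodule.subset_span (Or.inl ⟨_, mem_nPlus_iff.2 fun i j h0 => ?_, rfl⟩)
      exact ((he 0 i j h0).resolve_left (lt_irrefl 0)).2
    · exact Submodule.subset_span (Or.inr ⟨_, k, hpos, rfl⟩)

lemma isPositiveRoot_affWeight_iff {k : ℤ} {i j : Idx n} (hij : j ≠ i.dual) :
    IsPositiveRoot n (affWeight k i j) ↔ 0 < k ∨ k = 0 ∧ i.pos < j.pos := by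
  have hne := entry_mono_rootVec_ne_zero hij k
  constructor
  · rintro ⟨-, -, hle⟩
    exact (mem_nPlusAff_iff.1 (hle (mono_rootVec_mem_rootSpace k i j))).2.2 k i j hne
  · intro hpos
    have h0 : affWeight k i j ≠ 0 := by
      intro h
      have hzero : affWeight 0 i i = 0 := by ext; simp [affWeight_apply, weight_apply]
      obtain ⟨hk, h⟩ := eq_of_affWeight_eq hij (h.trans hzero.symm)
      have : i = j := by
        rcases h with ⟨-, h⟩ | ⟨h, h'⟩ | ⟨h, -⟩
        · exact h
        · exact dual_injective (h'.symm.trans h)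
        · exact h
      subst this
      omega
    refine ⟨h0, fun hbot => hne ?_, fun z hz => ?_⟩
    · rw [(Submodule.eq_bot_iff _).1 hbot _ (mono_rootVec_mem_rootSpace k i j), map_zero]
    · rw [rootSpace_eq_rootSum h0, mem_rootSum_iff] at hz
      refine mem_nPlusAff_iff.2 ⟨hz.1, hz.2.1, fun k' i' j' hz0 => ?_⟩
      obtain ⟨rfl, h⟩ := eq_of_affWeight_eq hij (hz.2.2 k' i' j' hz0).symm
      rcases h with ⟨rfl, rfl⟩ | ⟨rfl, rfl⟩ | ⟨rfl, rfl⟩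
      · exact hpos
      · rw [pos_dual, pos_dual]
        omega
      · exact Or.inl (hpos.resolve_right fun h => h.2.false)

lemma ne_dual_of_entry_ne_zero {z : GAff n} {k : ℤ} {i j : Idx n} (h : entry k i j z ≠ 0) :
    j ≠ i.dual := ne_dual_of_matEntry_ne_zero h

lemma nPlusAff_eq_rootSum : nPlusAff n = rootSum {α | IsPositiveRoot n α} := by
  ext z
  rw [mem_nPlusAff_iff, mem_rootSum_iff]
  refine and_congr_right' (and_congr_right' (forall₃_congr fun k i j => forall_congr' fun h0 => ?_))
  exact (isPositiveRoot_affWeight_iff (ne_dual_of_entry_ne_zero h0)).symm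

/-! ### Ideals given by sets of roots -/

/-- A set of positive roots is a root filter if it is stable under adding positive roots and
contains all roots of large degree, so that its root spaces add up to a combinatorial ideal. Sums
are taken along matrix positions: the weights at `(i, m)` and `(m, j)` add up to the weight at
`(i, j)`. -/
structure IsRootFilter (Φ : Set (Module.Dual ℂ (cartanAff n))) : Prop where
  isPositiveRoot : ∀ α ∈ Φ, IsPositiveRoot n α
  add_mem : ∀ {k l : ℤ} {i m j : Idx n}, m ≠ i.dual → j ≠ m.dual → j ≠ i.dual →
    IsPositiveRoot n (affWeight k i m) → affWeight l m j ∈ Φ → affWeight (k + l) i j ∈ Φ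
  large : ∃ N : ℕ, ∀ k : ℤ, N ≤ k → ∀ i j : Idx n, j ≠ i.dual → affWeight k i j ∈ Φ

namespace IsRootFilter

lemma coef_eq_zero_of_neg (hΦ : IsRootFilter Φ) {z : GAff n} (hz : z ∈ rootSum Φ) {k : ℤ}
    (hk : k < 0) : coef k z = 0 := by
  refine ext_matEntry fun i j => ?_
  rw [map_zero]
  by_contra h0
  have := hΦ.isPositiveRoot _ ((mem_rootSum_iff.1 hz).2.2 k i j h0)
  rw [isPositiveRoot_affWeight_iff (ne_dual_of_entry_ne_zero h0)] at this
  omega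

lemma mono_lie_mem (hΦ : IsRootFilter Φ) {x : G n} {k : ℤ} (hk : 0 ≤ k)
    (hx : ∀ i j, matEntry i j x ≠ 0 → IsPositiveRoot n (affWeight k i j)) {z : GAff n}
    (hz : z ∈ rootSum Φ) : ⁅mono n x k, z⁆ ∈ rootSum Φ := by
  obtain ⟨-, hd, he⟩ := mem_rootSum_iff.1 hz
  have key {l : ℤ} {i m j : Idx n} (hij : j ≠ i.dual) (hxm : matEntry i m x ≠ 0)
      (hzm : entry (l - k) m j z ≠ 0) : affWeight l i j ∈ Φ := by
    simpa using hΦ.add_mem (ne_dual_of_matEntry_ne_zero hxm) (ne_dual_of_entry_ne_zero hzm) hij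
      (hx i m hxm) (he _ m j hzm)
  refine mem_rootSum_iff.2 ⟨?_, degCoef_lie _ _, fun l i j h0 => ?_⟩
  · rw [centCoef_mono_lie]
    rcases hk.eq_or_lt with rfl | hk
    · rw [Int.cast_zero, zero_mul]
    · rw [hΦ.coef_eq_zero_of_neg hz (by omega), map_zero, mul_zero]
  · have hij := ne_dual_of_entry_ne_zero h0
    rw [entry_mono_lie x hd] at h0
    obtain ⟨m, -, hm⟩ := Finset.exists_ne_zero_of_sum_ne_zero h0
    by_cases h1 : matEntry i m x * entry (l - k) m j z = 0
    · rw [h1, zero_sub, neg_ne_zero] at hm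
      rw [← affWeight_dual_dual]
      refine key (m := m.dual) (fun h => hij (by rw [h, dual_dual])) ?_ ?_
      · exact matEntry_dual_dual_eq_zero_iff.not.2 (right_ne_zero_of_mul hm)
      · exact matEntry_dual_dual_eq_zero_iff.not.2 (left_ne_zero_of_mul hm)
    · exact key hij (left_ne_zero_of_mul h1) (right_ne_zero_of_mul h1)

lemma lie_mem (hΦ : IsRootFilter Φ) {x z : GAff n} (hx : x ∈ borelAff n) (hz : z ∈ rootSum Φ) :
    ⁅x, z⁆ ∈ rootSum Φ := by
  obtain ⟨h, hh, y, hy, rfl⟩ := Submodule.mem_sup.1 hx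
  rw [add_lie]
  refine AddMemClass.add_mem
    (mem_rootSum_iff.2 ⟨centCoef_cartanAff_lie hh z, degCoef_lie h z, ?_⟩) ?_
  · intro k i j h0
    rw [entry_cartanAff_lie ⟨h, hh⟩] at h0
    exact (mem_rootSum_iff.1 hz).2.2 k i j (right_ne_zero_of_mul h0)
  · rw [nPlusAff_eq_rootSum] at hy
    obtain ⟨hc, hd, he⟩ := mem_rootSum_iff.1 hy
    rw [eq_sum_mono hc hd, sum_lie]
    refine sum_mem fun k hk => hΦ.mono_lie_mem ?_ (fun i j => he k i j) hz
    by_contra hneg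
    refine Finsupp.mem_support_iff.1 hk (ext_matEntry fun i j => ?_)
    rw [map_zero]
    by_contra h0
    have := (isPositiveRoot_affWeight_iff (ne_dual_of_matEntry_ne_zero h0)).1 (he k i j h0)
    omega

end IsRootFilter

lemma coef_eq_zero_of_mem_borelAff {z : GAff n} (hz : z ∈ borelAff n) {k : ℤ} (hk : k < 0) :
    coef k z = 0 := by
  refine (sup_le (Submodule.span_le.2 ?_) (Submodule.span_le.2 ?_) :
    borelAff n ≤ LinearMap.ker (coef k)) hz
  · rintro _ ((rfl | rfl) | ⟨h, -, rfl⟩)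
    · exact coef_cElt k
    · exact coef_dElt k
    · exact (coef_mono h 0 k).trans (if_neg (by omega))
  · rintro _ (⟨x, -, rfl⟩ | ⟨x, l, hl, rfl⟩)
    · exact (coef_mono x 0 k).trans (if_neg (by omega))
    · exact (coef_mono x l k).trans (if_neg (by omega))

namespace IsRootFilter

lemma finite_codim (hΦ : IsRootFilter Φ) :
    FiniteDimensional ℂ (↥(borelAff n) ⧸ (rootSum Φ).submoduleOf (borelAff n)) := by
  obtain ⟨N, hN⟩ := hΦ.large
  let φ : borelAff n →ₗ[ℂ] (Fin N → G n) × ℂ × ℂ :=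
    ((LinearMap.pi fun k : Fin N => coef k).prod (centCoef.prod degCoef)).domRestrict (borelAff n)
  have hker : LinearMap.ker φ ≤ (rootSum Φ).submoduleOf (borelAff n) := by
    intro z hz
    have hz : ((fun k : Fin N => coef (k : ℤ) z.1), centCoef z.1, degCoef z.1) = 0 := hz
    simp only [Prod.mk_eq_zero] at hz
    refine mem_rootSum_iff.2 ⟨hz.2.1, hz.2.2, fun k i j h0 => ?_⟩
    refine hN k ?_ i j (ne_dual_of_entry_ne_zero h0)
    by_contra hk
    have hcoef : coef k z.1 = 0 := by
      rcases lt_or_ge k 0 with hneg | hnonneg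
      · exact coef_eq_zero_of_mem_borelAff z.2 hneg
      · lift k to ℕ using hnonneg
        exact congrFun hz.1 ⟨k, by omega⟩
    exact h0 (by rw [Submodule.subtype_apply, entry_apply, hcoef, map_zero])
  have : FiniteDimensional ℂ (↥(borelAff n) ⧸ LinearMap.ker φ) :=
    Module.Finite.equiv φ.quotKerEquivRange.symm
  exact Module.Finite.of_surjective (Submodule.factor hker) (Submodule.factor_surjective hker)

lemma rootSpace_le_rootSum (hΦ : IsRootFilter Φ) (hα : α ∈ Φ) : rootSpace n α ≤ rootSum Φ := by
  rw [rootSpace_eq_rootSum (hΦ.isPositiveRoot α hα).1]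
  exact rootSum_mono (Set.singleton_subset_iff.2 hα)

theorem isCombinatorialIdeal_rootSum (hΦ : IsRootFilter Φ) :
    IsCombinatorialIdeal n (rootSum Φ) where
  le_nPlus := nPlusAff_eq_rootSum (n := n) ▸ rootSum_mono hΦ.isPositiveRoot
  lie_mem _ hx _ hz := hΦ.lie_mem hx hz
  finite_codim := hΦ.finite_codim
  rootSpaces α hα := by
    by_cases h : α ∈ Φ
    · exact Or.inr (hΦ.rootSpace_le_rootSum h)
    · exact Or.inl (rootSum_inf_rootSpace_eq_bot hα.1 h)

theorem supp_rootSum (hΦ : IsRootFilter Φ) : supp n (rootSum Φ) = Φ := by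
  ext α
  refine ⟨fun ⟨hα, hle⟩ => ?_, fun h => ⟨hΦ.isPositiveRoot α h, hΦ.rootSpace_le_rootSum h⟩⟩
  by_contra h
  exact hα.2.1 (by rw [← rootSum_inf_rootSpace_eq_bot hα.1 h, inf_eq_right.2 hle])

end IsRootFilter

/-! ### Sums of roots in the support of an ideal -/

lemma mem_supp_of_entry_ne_zero {I : Submodule ℂ (GAff n)} (hI : IsCombinatorialIdeal n I)
    {z : GAff n} (hz : z ∈ I) {k : ℤ} {i j : Idx n} (hzα : z ∈ rootSpace n (affWeight k i j))
    (h0 : entry k i j z ≠ 0) : affWeight k i j ∈ supp n I := by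
  have hα : IsPositiveRoot n (affWeight k i j) :=
    (isPositiveRoot_affWeight_iff (ne_dual_of_entry_ne_zero h0)).2
      ((mem_nPlusAff_iff.1 (hI.le_nPlus hz)).2.2 k i j h0)
  refine ⟨hα, (hI.rootSpaces _ hα).resolve_left fun hbot => h0 ?_⟩
  rw [(Submodule.eq_bot_iff _).1 hbot z ⟨hz, hzα⟩, map_zero]

lemma lie_mem_rootSpace {α β : Module.Dual ℂ (cartanAff n)} {x y : GAff n}
    (hx : x ∈ rootSpace n α) (hy : y ∈ rootSpace n β) : ⁅x, y⁆ ∈ rootSpace n (α + β) := by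
  intro h
  rw [leibniz_lie, hx h, hy h, smul_lie, lie_smul, LinearMap.add_apply, add_smul]

lemma affWeight_add (k l : ℤ) (i m j : Idx n) :
    affWeight k i m + affWeight l m j = affWeight (k + l) i j := by
  ext h
  simp only [LinearMap.add_apply, affWeight_apply, weight_apply, Int.cast_add]
  ring

lemma matEntry_rootVec_lie_rootVec {i m j : Idx n} (him : i ≠ m) (him' : m ≠ i.dual)
    (hmj : j ≠ m.dual) (hij : j ≠ i.dual) :
    matEntry i j ⁅rootVec i m, rootVec m j⁆ = m.form * j.form := by
  have h1 (k : Idx n) (hk : k ≠ m) : matEntry i k (rootVec i m) = 0 := by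
    by_contra h0
    rcases of_matEntry_rootVec_ne_zero h0 with h | h
    · exact hk h.2
    · exact him' (by rw [h.1, dual_dual])
  have h2 (k : Idx n) : matEntry i k (rootVec m j) = 0 := by
    by_contra h0
    rcases of_matEntry_rootVec_ne_zero h0 with h | h
    · exact him h.1
    · exact hij (by rw [h.1, dual_dual])
  rw [matEntry_lie, Finset.sum_eq_single_of_mem m (Finset.mem_univ m), h2, zero_mul, sub_zero,
    matEntry_rootVec_self him', matEntry_rootVec_self hmj]
  intro k _ hk
  rw [h1 k hk, h2, zero_mul, zero_mul, sub_zero]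

lemma affWeight_add_mem_supp {I : Submodule ℂ (GAff n)} (hI : IsCombinatorialIdeal n I) {k l : ℤ}
    {i m j : Idx n} (him : i ≠ m) (him' : m ≠ i.dual) (hmj : j ≠ m.dual) (hij : j ≠ i.dual)
    (hpos : IsPositiveRoot n (affWeight k i m)) (h : affWeight l m j ∈ supp n I) :
    affWeight (k + l) i j ∈ supp n I := by
  have hx := mono_rootVec_mem_rootSpace k i m
  have hy := mono_rootVec_mem_rootSpace l m j
  refine mem_supp_of_entry_ne_zero hI (hI.lie_mem _ (le_sup_right (a := cartanAff n)
    (hpos.2.2 hx)) _ (h.2 hy)) (affWeight_add k l i m j ▸ lie_mem_rootSpace hx hy) ?_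
  rw [entry_apply, coef_mono_lie, degCoef_mono, zero_mul, zero_smul, sub_zero,
    add_sub_cancel_left, coef_mono, if_pos rfl, matEntry_rootVec_lie_rootVec him him' hmj hij]
  exact mul_ne_zero (form_ne_zero m) (form_ne_zero j)

/-! ### The root filter of a compatible pair of words -/

variable {p q : List Letter}

variable (n p q) in
/-- The roots in the support of the ideal which `p` and `q` are to define: the root at position
`(u, v)` of the coefficient at `t^k` belongs to it if `k = 0` and its box lies to the northeast of
`p`, or `k = 1` and its box, should it have one, lies to the northeast of `q`, or `2 ≤ k`. The
minima choose between the position `(u, v)` and its dual `(2n+2-v, 2n+2-u)`. -/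
def Supported (k u v : ℤ) : Prop :=
  (k = 0 ∧ u < v ∧ LowerBox p (min u (2 * n + 2 - v)) (min (v - 1) (2 * n + 1 - u))) ∨
  (k = 1 ∧ (v < u → UpperBox q (min v (2 * n + 2 - u)) (min (u - 1) (2 * n + 1 - v)))) ∨ 2 ≤ k

lemma Supported.dual {k u v : ℤ} (h : Supported n p q k u v) :
    Supported n p q k (2 * n + 2 - v) (2 * n + 2 - u) := by
  rcases h with ⟨hk, huv, h⟩ | ⟨hk, h⟩ | hk
  · exact Or.inl ⟨hk, by omega, h.mono (by omega) (by omega)⟩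
  · exact Or.inr (Or.inl ⟨hk, fun huv => (h (by omega)).mono (by omega) (by omega)⟩)
  · exact Or.inr (Or.inr hk)

lemma Supported.of_lt {k u m v : ℤ} (hum : u < m) (h : Supported n p q k m v) :
    Supported n p q k u v := by
  rcases h with ⟨hk, hmv, h⟩ | ⟨hk, h⟩ | hk
  · exact Or.inl ⟨hk, by omega, h.mono (by omega) (by omega)⟩
  · exact Or.inr (Or.inl ⟨hk, fun huv => (h (by omega)).mono (by omega) (by omega)⟩)
  · exact Or.inr (Or.inr hk)

/-- A root of the first row carries to the second row of the upper triangle, every other root to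
the first row. -/
lemma Compatible.supported_one (hpq : Compatible n p q) {u m v : ℤ} (hm : 1 ≤ m)
    (hu : u ≤ 2 * n + 1) (hum : u + m ≠ 2 * n + 2) (hmv : m + v ≠ 2 * n + 2)
    (huv : u + v ≠ 2 * n + 2) (h : Supported n p q 0 m v) : Supported n p q 1 u v := by
  refine Or.inr (Or.inl ⟨rfl, fun hlt => ?_⟩)
  obtain ⟨hmv', h⟩ : m < v ∧ LowerBox p (min m (2 * n + 2 - v)) (min (v - 1) (2 * n + 1 - m)) := by
    simpa [Supported] using h
  by_cases hm1 : m = 1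
  · exact ((hpq (max 2 (v - 1)) (by omega) (by omega)).1 (h.mono (by omega) (by omega))).mono
      (by omega) (by omega)
  · exact ((hpq (min (v - 1) (2 * n + 1 - m)) (by omega) (by omega)).2
      (h.mono (by omega) le_rfl)).mono (by omega) (by omega)

variable (n p q) in
/-- The set of the roots at the positions allowed by `Supported`. -/
def pathRoots : Set (Module.Dual ℂ (cartanAff n)) :=
  {α | ∃ (k : ℤ) (i j : Idx n), j ≠ i.dual ∧ Supported n p q k i.pos j.pos ∧ α = affWeight k i j}

lemma affWeight_mem_pathRoots_iff {k : ℤ} {i j : Idx n} (hij : j ≠ i.dual) :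
    affWeight k i j ∈ pathRoots n p q ↔ Supported n p q k i.pos j.pos := by
  refine ⟨?_, fun h => ⟨k, i, j, hij, h, rfl⟩⟩
  rintro ⟨k', i', j', hij', h, heq⟩
  obtain ⟨rfl, hpos⟩ := eq_of_affWeight_eq hij' heq.symm
  rcases hpos with ⟨rfl, rfl⟩ | ⟨rfl, rfl⟩ | ⟨rfl, rfl⟩
  · exact h
  · rw [pos_dual, pos_dual]
    exact h.dual
  · rcases h with ⟨-, h, -⟩ | ⟨hk, -⟩ | hk
    · exact (lt_irrefl _ h).elim
    · exact Or.inr (Or.inl ⟨hk, fun h => (lt_irrefl _ h).elim⟩)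
    · exact Or.inr (Or.inr hk)

lemma Compatible.isRootFilter_pathRoots (hpq : Compatible n p q) :
    IsRootFilter (pathRoots n p q) where
  isPositiveRoot := by
    rintro _ ⟨k, i, j, hij, h, rfl⟩
    rw [isPositiveRoot_affWeight_iff hij]
    rcases h with ⟨hk, h, -⟩ | ⟨hk, -⟩ | hk
    · exact Or.inr ⟨hk, h⟩
    all_goals omega
  add_mem {k l i m j} him hmj hij hpos h := by
    rw [affWeight_mem_pathRoots_iff hmj] at h
    rw [affWeight_mem_pathRoots_iff hij]
    rw [isPositiveRoot_affWeight_iff him] at hpos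
    rcases hpos with hk | ⟨rfl, hlt⟩
    · by_cases hkl : k = 1 ∧ l = 0
      · obtain ⟨rfl, rfl⟩ := hkl
        rw [Ne, eq_dual_iff] at him hmj hij
        exact hpq.supported_one (one_le_pos m) (pos_le i) him hmj hij h
      · refine Or.inr (Or.inr ?_)
        rcases h with ⟨hl, -⟩ | ⟨hl, -⟩ | hl <;> omega
    · rw [zero_add]
      exact h.of_lt hlt
  large := ⟨2, fun _ hk _ _ hij => (affWeight_mem_pathRoots_iff hij).2 (Or.inr (Or.inr hk))⟩

lemma rootD2_mem_pathRoots_iff {r s : ℕ} (hrs : IsRootIndex n r s) :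
    rootD2 n r s ∈ pathRoots n p q ↔ LowerBox p r s := by
  obtain ⟨i, j, hi, hj⟩ := hrs.exists_idx
  have ⟨_, h2, h3⟩ := hrs
  rw [rootD2_eq_affWeight hrs hi hj,
    affWeight_mem_pathRoots_iff (by rw [Ne, eq_dual_iff]; omega), hi, hj]
  constructor
  · rintro (⟨-, -, h⟩ | ⟨h, -⟩ | h)
    · exact h.mono (by omega) (by omega)
    all_goals omega
  · exact fun h => Or.inl ⟨rfl, by omega, h.mono (by omega) (by omega)⟩

lemma rootD3_mem_pathRoots_iff {r s : ℕ} (hrs : IsRootIndex n r s) :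
    rootD3 n r s ∈ pathRoots n p q ↔ UpperBox q r s := by
  obtain ⟨i, j, hi, hj⟩ := hrs.exists_idx
  have ⟨_, h2, h3⟩ := hrs
  rw [rootD3_eq_affWeight hrs hi hj,
    affWeight_mem_pathRoots_iff (by rw [Ne, eq_dual_iff]; omega), hi, hj]
  constructor
  · rintro (⟨h, -⟩ | ⟨-, h⟩ | h)
    · omega
    · exact (h (by omega)).mono (by omega) (by omega)
    · omega
  · exact fun h => Or.inr (Or.inl ⟨rfl, fun _ => h.mono (by omega) (by omega)⟩)

lemma delta_mem_pathRoots (hn : 0 < n) : delta n ∈ pathRoots n p q := by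
  obtain ⟨i, hi⟩ := exists_pos_eq (n := n) (u := 1) (by omega) (by omega)
  rw [delta_eq_affWeight i, affWeight_mem_pathRoots_iff (by rw [Ne, eq_dual_iff]; omega)]
  exact Or.inr (Or.inl ⟨rfl, fun h => (lt_irrefl _ h).elim⟩)

/-! ### Admissible pairs -/

lemma rootD3_mem_supp_of_rootD2_mem_supp {I : Submodule ℂ (GAff n)}
    (hI : IsCombinatorialIdeal n I) {r r' s : ℕ} (hr : r ≠ r') (hrs : IsRootIndex n r s)
    (hrs' : IsRootIndex n r' (2 * n - s)) (h : rootD2 n r s ∈ supp n I) :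
    rootD3 n r' (2 * n - s) ∈ supp n I := by
  obtain ⟨m, j, hm, hj⟩ := hrs.exists_idx
  obtain ⟨i, -, hi, -⟩ := hrs'.exists_idx
  rw [rootD2_eq_affWeight hrs hm hj] at h
  rw [rootD3_eq_affWeight hrs' hi (j := j.dual) (by rw [pos_dual, hj]; have := hrs.2.2; omega),
    ← affWeight_dual_dual, dual_dual, ← add_zero (1 : ℤ)]
  obtain ⟨-, hle, hadd⟩ := hrs
  obtain ⟨-, hle', hadd'⟩ := hrs'
  have hmi : m ≠ i.dual.dual := by
    rw [dual_dual, Ne, ← pos_injective.eq_iff]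
    omega
  refine affWeight_add_mem_supp hI (m := m) ?_ hmi ?_ ?_
    ((isPositiveRoot_affWeight_iff hmi).2 (Or.inl one_pos)) h
  · rw [Ne, eq_comm, eq_dual_iff]
    omega
  · rw [Ne, eq_dual_iff]
    omega
  · rw [dual_dual, Ne, ← pos_injective.eq_iff]
    omega

lemma IsPathPair.compatible {I : Submodule ℂ (GAff n)} (hI : IsCombinatorialIdeal n I)
    (hpq : IsPathPair n I p q) : Compatible n p q := by
  intro s hs2 hs
  lift s to ℕ using by omega
  have key {r r' : ℕ} (hr : r ≠ r') (hrs : IsRootIndex n r s)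
      (hrs' : IsRootIndex n r' (2 * n - s)) (h : LowerBox p r s) : UpperBox q r' (2 * n - s) := by
    rw [← isNortheast_lowerPath_iff, ← hpq.left_separates r s hrs] at h
    have := rootD3_mem_supp_of_rootD2_mem_supp hI hr hrs hrs' h
    rw [hpq.right_separates _ _ hrs', isNortheast_upperPath_iff] at this
    exact this.mono le_rfl (by omega)
  exact ⟨key (r := 1) (r' := 2) (by omega) ⟨by omega, by omega, by omega⟩
      ⟨by omega, by omega, by omega⟩,
    key (r := 2) (r' := 1) (by omega) ⟨by omega, by omega, by omega⟩
      ⟨by omega, by omega, by omega⟩⟩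

theorem isAdmissible_iff (hn : 0 < n) :
    IsAdmissible n p q ↔ IsBPath n p ∧ IsBPath n q ∧ Compatible n p q := by
  constructor
  · rintro ⟨I, ⟨hI, -⟩, hpq⟩
    exact ⟨hpq.left_isBPath, hpq.right_isBPath, hpq.compatible hI⟩
  · rintro ⟨hp, hq, hpq⟩
    have hΦ := hpq.isRootFilter_pathRoots
    refine ⟨rootSum (pathRoots n p q), ⟨hΦ.isCombinatorialIdeal_rootSum, delta n, ?_⟩,
      hp, hq, fun r s hrs => ?_, fun r s hrs => ?_⟩
    · rw [hΦ.supp_rootSum]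
      exact ⟨delta_mem_pathRoots hn, Or.inl (Or.inl rfl)⟩
    · rw [hΦ.supp_rootSum, rootD2_mem_pathRoots_iff hrs, isNortheast_lowerPath_iff]
    · rw [hΦ.supp_rootSum, rootD3_mem_pathRoots_iff hrs, isNortheast_upperPath_iff]

end AffineB

end

theorem mainTheorem4 (n a b : ℕ) (ha : 3 ≤ a) (hab : a < b) (hb : b ≤ 2 * n)
    (p : List AffineB.Letter) (hp : p ∈ AffineB.B n a b) :
    (∀ q : List AffineB.Letter, AffineB.IsAdmissible n p q ↔
      ∃ i j : ℕ, 2 * n + 4 - b ≤ i ∧ 2 * n + 4 - a ≤ j ∧ q ∈ AffineB.B n i j) ∧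
    {q : List AffineB.Letter | AffineB.IsAdmissible n p q}.ncard =
      ∑ i ∈ Finset.Icc (2 * n + 4 - b) (2 * n + 2),
        ∑ j ∈ Finset.Icc (2 * n + 4 - a) (2 * n + 2), (AffineB.B n i j).ncard := by
  have h (q : List AffineB.Letter) : AffineB.IsAdmissible n p q ↔
      ∃ i j : ℕ, 2 * n + 4 - b ≤ i ∧ 2 * n + 4 - a ≤ j ∧ q ∈ AffineB.B n i j := by
    rw [AffineB.isAdmissible_iff (by omega), ← AffineB.isBPath_and_compatible_iff ha hab hb hp]
    exact and_iff_right hp.1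
  refine ⟨h, ?_⟩
  rw [← AffineB.ncard_setOf_exists_mem_B]
  exact congrArg Set.ncard (Set.ext h)
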